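/- Let $\mathrm F$ be a quadratically closed field, i.e. every element of $\mathrm F$ is a square. *Formal polylogarithms.* For a field $\mathrm F$ the Lie coalgebra $\mathcal L_\bullet(\mathrm F)=\bigoplus_{n\ge1}\mathcal L_n(\mathrm F)$ of formal polylogarithms is the following. The $\mathbb Q$-vector space $\mathcal L_n(\mathrm F)$ is spanned by symbols $\mathrm{Cor}(x_0,\dots,x_n)$, $x_i\in \mathrm F$, and $$\Delta\,\mathrm{Cor}(x_0,\dots,x_n)=\sum_{i\in\mathbb Z/(n+1)}\ \sum_{j=1}^{n-1}\mathrm{Cor}(x_i,x_{i+1},\dots,x_{i+j})\wedge \mathrm{Cor}(x_i,x_{i+j+1},\dots,x_{i+n}).$$ The relations are defined by induction on $n$, for all fields at once. For $n=1$, $\mathrm{Cor}(x,y)\mapsto (x-y)\otimes 1$ (and $\mathrm{Cor}(x,x)\mapsto 0$) identifies $\mathcal L_1(\mathrm F)$ with $\mathrm F^\times\otimes\mathbb Q$. For $n\ge 2$ the relations are: $\mathrm{Cor}(x_0,\dots,x_n)=0$ if all $x_i$ but at most one are equal; $\mathrm{Cor}(cx_0+b,\dots,cx_n+b)=\mathrm{Cor}(x_0,\dots,x_n)$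 for $c\in \mathrm F^\times$, $b\in \mathrm F$; and $\mathrm{Sp}_{t=a}\xi=\mathrm{Sp}_{t=b}\xi$ for all $a,b\in \mathrm F$ and every formal combination $\xi$ of symbols $\mathrm{Cor}(x_0,\dots,x_n)$ over $\mathrm F(t)$ whose cobracket vanishes modulo the relations of lower weight over $\mathrm F(t)$. Here $\mathrm{Sp}_{t=a}\mathrm{Cor}(x_0,\dots,x_n)$ is $\mathrm{Cor}$ of the values at $t=a$ of $x_0,\dots,x_n$, after an affine transformation over $\mathrm F(t)$ that makes all of them regular at $a$ with values not all equal (and it is $0$ if $x_0=\dots=x_n$). (Precisely, one takes the elements of the span of these relations that $\Delta$ maps to $0$ modulo relations of lower weight, so that $\Delta$ is defined on $\mathcal L_\bullet(\mathrm F)$.) Put $I(x_0;x_1,\dots,x_n;x_{n+1})=\mathrm{Cor}(x_1,\dots,x_{n+1})-\mathrm{Cor}(x_0,\dots,x_n)$ and, for $n_0\ge0$, $n_1,\dots,n_k\ge1$, $a_1,\dots,a_k\in \mathrm F^\times$, $$\mathrm{Li}^{\mathcal L}_{n_0;n_1,\dots,n_k}(a_1,\dots,a_k)=(-1)^k I(0;\{0\}^{n_0},1,\{0\}^{n_1-1},a_1,\{0\}^{n_2-1},a_1a_2,\dots,a_1\cdots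 a_{k-1},\{0\}^{n_k-1};a_1\cdots a_k),$$ an element of weight $n_0+n_1+\dots+n_k$ and depth $k$. *The map.* Let $\mathcal D_d\mathcal L_{\ge2}(\mathrm F)$ be the span of all $\mathrm{Li}^{\mathcal L}_{n_0;n_1,\dots,n_k}(a_1,\dots,a_k)$ of weight at least $2$ and depth $1\le k\le d$, let $\mathrm{gr}^{\mathcal D}_d\mathcal L_{\ge2}(\mathrm F)=\mathcal D_d\mathcal L_{\ge2}(\mathrm F)/\mathcal D_{d-1}\mathcal L_{\ge2}(\mathrm F)$, and let $\mathcal B_n(\mathrm F)$ be the span of the classical polylogarithms $\mathrm{Li}^{\mathcal L}_n(a)=\mathrm{Li}^{\mathcal L}_{0;n}(a)$, $a\in\mathrm F^\times$. Let $\overline\Delta$ be the truncated cobracket, obtained from $\Delta$ by omitting the components $\mathcal L_1\wedge\mathcal L_{n-1}$. For a $\mathbb Q$-vector space $V$ let $\mathrm{coLie}_d(V)$ be the degree $d$ component of the cofree Lie coalgebra cogenerated by $V$, i.e. $V^{\otimes d}$ modulo all shuffle products of tensors of positive degree, and let $\overline\Delta^{[d-1]}\colon \mathcal L_{\ge 2}(\mathrm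 F)\to\mathrm{coLie}_d(\mathcal L_{\ge2}(\mathrm F))$ be the iterated truncated cobracket: $\frac1d$ times the class of $(\mathrm{id}^{\otimes(d-2)}\otimes\overline\Delta)\circ\dots\circ(\mathrm{id}\otimes\overline\Delta)\circ\overline\Delta$, where $a\wedge b$ is read as $a\otimes b-b\otimes a$. **Theorem.** For every $d\ge1$ the map $\overline\Delta^{[d-1]}$ induces a (unique) linear map $$\overline\Delta^{[d-1]}\colon \mathrm{gr}^{\mathcal D}_d\mathcal L_{\ge2}(\mathrm F)\longrightarrow \mathrm{coLie}_d\Big(\bigoplus_{n\ge2}\mathcal B_n(\mathrm F)\Big),$$ and this map is surjective. -/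

import Mathlib

open scoped TensorProduct

noncomputable section

namespace Polylog

universe u

/-! ### Formal correlators and their cobracket -/

/-- The free `ℚ`-vector space on words in `F`. The word `[x₀, …, xₙ]` stands for the formal
correlator `Cor(x₀, …, xₙ)`, which has weight `n`. -/
abbrev Sym (F : Type u) : Type u := List F →₀ ℚ

/-- The formal correlator `Cor(x₀, …, xₙ)`. -/
def cor {F : Type u} (w : List F) : Sym F := Finsupp.single w 1

/-- `a ∧ b`, viewed as the antisymmetric tensor `a ⊗ b - b ⊗ a` (over `ℚ` this identifies the
exterior square with the antisymmetric part of the tensor square). -/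
def wedge {V : Type u} [AddCommGroup V] [Module ℚ V] (a b : V) : V ⊗[ℚ] V :=
  a ⊗ₜ[ℚ] b - b ⊗ₜ[ℚ] a

/-- The cobracket of a formal correlator:
`Δ Cor(x₀,…,xₙ) = ∑_{i ∈ ℤ/(n+1)} ∑_{j=1}^{n-1} Cor(xᵢ,xᵢ₊₁,…,xᵢ₊ⱼ) ∧ Cor(xᵢ,xᵢ₊ⱼ₊₁,…,xᵢ₊ₙ)`.
With `I(x₀;x₁,…,xₙ;xₙ₊₁) = Cor(x₁,…,xₙ₊₁) - Cor(x₀,…,xₙ)` this is the formula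
`Δ I(x₀;…;xₙ₊₁) = ∑_{i<j} I(x₀;x₁,…,xᵢ,xⱼ,…,xₙ;xₙ₊₁) ∧ I(xᵢ;xᵢ₊₁,…,xⱼ₋₁;xⱼ)`. -/
def symCobracketWord {F : Type u} (w : List F) : Sym F ⊗[ℚ] Sym F :=
  ∑ i ∈ Finset.range w.length, ∑ j ∈ Finset.Ico 1 (w.length - 1),
    wedge (cor ((w.rotate i).take (j + 1)))
      (cor ((w.rotate i).take 1 ++ (w.rotate i).drop (j + 1)))

/-- The cobracket on formal combinations of correlators. -/
def symCobracket (F : Type u) : Sym F →ₗ[ℚ] Sym F ⊗[ℚ] Sym F :=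
  Finsupp.linearCombination ℚ symCobracketWord

/-- The cobracket, with values in the tensor square of the quotient by `N`. -/
def symCobracketMod {F : Type u} (N : Submodule ℚ (Sym F)) :
    Sym F →ₗ[ℚ] (Sym F ⧸ N) ⊗[ℚ] (Sym F ⧸ N) :=
  TensorProduct.map N.mkQ N.mkQ ∘ₗ symCobracket F

/-- Formal combinations of correlators of weight `n`. -/
def symWeight (F : Type u) (n : ℕ) : Submodule ℚ (Sym F) :=
  Finsupp.supported ℚ ℚ {w : List F | w.length = n + 1}

/-! ### Specialization -/

/-- The word `w` of rational functions specializes to the word `v` at `t = a`: some affine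
transformation over `F(t)` makes all letters regular at `a` with values not all equal, and `v` is
the word of these values. Every word `w` whose letters are not all equal has such a
specialization, which is unique up to an affine transformation over `F`. -/
def IsSpecialization {F : Type u} [Field F] (a : F) (w : List (RatFunc F)) (v : List F) : Prop :=
  (∃ c b : RatFunc F, c ≠ 0 ∧
    List.Forall₂ (fun x y => (c * x + b).denom.eval a ≠ 0 ∧
      (c * x + b).eval (RingHom.id F) a = y) w v) ∧
  ∃ y ∈ v, ∃ z ∈ v, y ≠ z

open Classical in
/-- Specialization of a correlator at `t = a`; it is `0` if all letters are equal. -/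
def specializeWord {F : Type u} [Field F] (a : F) (w : List (RatFunc F)) : Sym F :=
  if h : ∃ v, IsSpecialization a w v then cor h.choose else 0

/-- Specialization of combinations of correlators at `t = a`. -/
def specialize {F : Type u} [Field F] (a : F) : Sym (RatFunc F) →ₗ[ℚ] Sym F :=
  Finsupp.linearCombination ℚ (specializeWord a)

/-! ### The relations between polylogarithms -/

/-- All letters of the word, except possibly one, are equal. -/
def IsDegenerate {F : Type u} (w : List F) : Prop :=
  ∃ (c x : F) (k l : ℕ), w = List.replicate k c ++ x :: List.replicate l c

open Classical in
/-- In weight one, `Cor(x, y)` is `log (x - y)`, an element of `Fˣ ⊗ ℚ`, and `Cor(x, x) = 0`. -/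
def logWord {F : Type u} [Field F] : List F → ℚ ⊗[ℤ] Additive Fˣ
  | [x, y] => if h : x - y ≠ 0 then 1 ⊗ₜ Additive.ofMul (Units.mk0 (x - y) h) else 0
  | _ => 0

/-- The kernel of `Cor(x, y) ↦ log (x - y)` in weight one. -/
def relOne (F : Type u) [Field F] : Submodule ℚ (Sym F) :=
  symWeight F 1 ⊓ LinearMap.ker (Finsupp.linearCombination ℚ (logWord (F := F)))

/-- The generators of the relations in weight `n ≥ 2`, where `N` and `N'` are the spaces of
relations of weight `< n` over `F(t)`, and over `F`, respectively:
* degenerate correlators vanish;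
* correlators are invariant under affine transformations;
* functional equations: if a combination `ξ` of correlators over `F(t)` has zero cobracket (modulo
  the relations of lower weight), it is constant: its specializations at any two points agree. -/
def relGenerators (F : Type u) [Field F] (n : ℕ) (N : Submodule ℚ (Sym (RatFunc F))) :
    Set (Sym F) :=
  {r | ∃ w : List F, w.length = n + 1 ∧ IsDegenerate w ∧ r = cor w} ∪
  {r | ∃ (w : List F) (c b : F), w.length = n + 1 ∧ c ≠ 0 ∧
    r = cor (w.map fun x => c * x + b) - cor w} ∪
  {r | ∃ (ξ : Sym (RatFunc F)) (a b : F), ξ ∈ symWeight (RatFunc F) n ∧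
    symCobracketMod N ξ = 0 ∧ r = specialize a ξ - specialize b ξ}

/-- The relations of weight at most `n`, by induction on the weight, over all fields at once.
There is nothing in weight `0`. The cobracket of the relations in `relGenerators` vanishes modulo
the relations of lower weight, because specialization commutes with the cobracket; the
intersection with the kernel of the cobracket makes this visible in the definition. -/
def relLE : ℕ → ∀ (F : Type u) [Field F], Submodule ℚ (Sym F)
  | 0, F, _ => Finsupp.supported ℚ ℚ {w : List F | w.length ≤ 1}
  | 1, F, _ => relLE 0 F ⊔ relOne F
  | n + 2, F, _ => relLE (n + 1) F ⊔
      (Submodule.span ℚ (relGenerators F (n + 2) (relLE (n + 1) (RatFunc F))) ⊓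
        LinearMap.ker (symCobracketMod (relLE (n + 1) F)))

/-- All relations. -/
def rel (F : Type u) [Field F] : Submodule ℚ (Sym F) := ⨆ n, relLE n F

/-! ### The Lie coalgebra of formal polylogarithms -/

/-- The Lie coalgebra `𝓛(F)` of formal polylogarithms with values in `F` (the sum of all its
weight components). -/
abbrev L (F : Type u) [Field F] : Type u := Sym F ⧸ rel F

lemma symCobracketMod_eq_zero_of_le {F : Type u} {N N' : Submodule ℚ (Sym F)} (h : N ≤ N')
    {r : Sym F} (hr : symCobracketMod N r = 0) : symCobracketMod N' r = 0 := by
  have : symCobracketMod N' =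
      TensorProduct.map (Submodule.factor h) (Submodule.factor h) ∘ₗ symCobracketMod N := by
    unfold symCobracketMod
    rw [← LinearMap.comp_assoc, ← TensorProduct.map_comp, Submodule.factor_comp_mk]
  rw [this, LinearMap.comp_apply, hr, map_zero]

lemma symCobracket_eq_zero_of_short {F : Type u} {r : Sym F}
    (hr : r ∈ Finsupp.supported ℚ ℚ {w : List F | w.length ≤ 2}) : symCobracket F r = 0 := by
  rw [symCobracket, Finsupp.linearCombination_apply, Finsupp.sum]
  refine Finset.sum_eq_zero fun w hw => ?_
  have h2 : w.length ≤ 2 := hr hw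
  have : symCobracketWord w = 0 := by
    unfold symCobracketWord
    rw [Finset.Ico_eq_empty (by omega)]
    simp
  rw [this, smul_zero]

lemma relLE_one_short (F : Type u) [Field F] :
    relLE 1 F ≤ Finsupp.supported ℚ ℚ {w : List F | w.length ≤ 2} := by
  rw [relLE, relLE]
  refine sup_le (Finsupp.supported_mono fun w hw => ?_)
    (inf_le_left.trans (Finsupp.supported_mono fun w hw => ?_))
  · simp only [Set.mem_ofPred_eq] at hw ⊢; omega
  · simp only [Set.mem_ofPred_eq] at hw ⊢; omega

lemma relLE_mono_succ (n : ℕ) (F : Type u) [Field F] : relLE n F ≤ relLE (n + 1) F := by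
  cases n with
  | zero => rw [relLE.eq_def 1]; exact le_sup_left
  | succ n => rw [relLE.eq_def (n + 2)]; exact le_sup_left

lemma rel_le_ker_symCobracketMod (F : Type u) [Field F] :
    rel F ≤ LinearMap.ker (symCobracketMod (rel F)) := by
  refine iSup_le fun n => ?_
  induction n with
  | zero =>
    intro r hr
    have := relLE_one_short F (relLE_mono_succ 0 F hr)
    rw [LinearMap.mem_ker, symCobracketMod, LinearMap.comp_apply,
      symCobracket_eq_zero_of_short this, map_zero]
  | succ n ih =>
    cases n with
    | zero =>
      intro r hr
      have := relLE_one_short F hr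
      rw [LinearMap.mem_ker, symCobracketMod, LinearMap.comp_apply,
        symCobracket_eq_zero_of_short this, map_zero]
    | succ n =>
      rw [relLE.eq_def (n + 2)]
      refine sup_le ih (inf_le_right.trans fun r hr => ?_)
      exact symCobracketMod_eq_zero_of_le (le_iSup (fun n => relLE n F) (n + 1)) hr

/-- The cobracket `Δ` of `𝓛(F)`. -/
def cobracket (F : Type u) [Field F] : L F →ₗ[ℚ] L F ⊗[ℚ] L F :=
  (rel F).liftQ (symCobracketMod (rel F)) (rel_le_ker_symCobracketMod F)

/-- The projection that removes the correlators of weight at most one. -/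
def symTrunc (F : Type u) : Sym F →ₗ[ℚ] Sym F :=
  Finsupp.linearCombination ℚ fun w => if 3 ≤ w.length then cor w else 0

lemma symTrunc_eq_zero {F : Type u} {r : Sym F}
    (hr : r ∈ Finsupp.supported ℚ ℚ {w : List F | w.length ≤ 2}) : symTrunc F r = 0 := by
  rw [symTrunc, Finsupp.linearCombination_apply, Finsupp.sum]
  refine Finset.sum_eq_zero fun w hw => ?_
  have h2 : w.length ≤ 2 := hr hw
  rw [if_neg (by omega), smul_zero]

lemma symTrunc_eq_self {F : Type u} {n : ℕ} {r : Sym F} (hr : r ∈ symWeight F (n + 2)) :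
    symTrunc F r = r := by
  rw [symTrunc, Finsupp.linearCombination_apply]
  conv_rhs => rw [← Finsupp.sum_single r]
  refine Finset.sum_congr rfl fun w hw => ?_
  have h2 : w.length = n + 2 + 1 := hr hw
  have h3 : 3 ≤ w.length := by omega
  simp only [h3, if_true, cor, Finsupp.smul_single, smul_eq_mul, mul_one]

lemma cor_mem_symWeight {F : Type u} {n : ℕ} {w : List F} (hw : w.length = n + 1) :
    cor w ∈ symWeight F n :=
  Finsupp.single_mem_supported ℚ 1 hw

lemma specialize_mem {F : Type u} [Field F] {n : ℕ} (a : F) {ξ : Sym (RatFunc F)}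
    (h : ξ ∈ symWeight (RatFunc F) n) : specialize a ξ ∈ symWeight F n := by
  rw [specialize, Finsupp.linearCombination_apply, Finsupp.sum]
  refine Submodule.sum_mem _ fun w hw => Submodule.smul_mem _ _ ?_
  have h2 : w.length = n + 1 := h hw
  unfold specializeWord
  split_ifs with hv
  · obtain ⟨⟨c, b, -, hf⟩, -⟩ := hv.choose_spec
    exact cor_mem_symWeight (hf.length_eq ▸ h2)
  · exact Submodule.zero_mem _

lemma relGenerators_subset (F : Type u) [Field F] (n : ℕ) (N : Submodule ℚ (Sym (RatFunc F))) :
    relGenerators F n N ⊆ symWeight F n := by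
  rintro r ((⟨w, hw, -, rfl⟩ | ⟨w, c, b, hw, -, rfl⟩) | ⟨ξ, a, b, hξ, -, rfl⟩)
  · exact cor_mem_symWeight hw
  · exact Submodule.sub_mem _ (cor_mem_symWeight (by simpa using hw)) (cor_mem_symWeight hw)
  · exact Submodule.sub_mem _ (specialize_mem a hξ) (specialize_mem b hξ)

lemma rel_le_comap_symTrunc (F : Type u) [Field F] :
    rel F ≤ (rel F).comap (symTrunc F) := by
  refine iSup_le fun n => ?_
  induction n with
  | zero =>
    intro r hr
    rw [Submodule.mem_comap, symTrunc_eq_zero (relLE_one_short F (relLE_mono_succ 0 F hr))]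
    exact Submodule.zero_mem _
  | succ n ih =>
    cases n with
    | zero =>
      intro r hr
      rw [Submodule.mem_comap, symTrunc_eq_zero (relLE_one_short F hr)]
      exact Submodule.zero_mem _
    | succ n =>
      rw [relLE.eq_def (n + 2)]
      refine sup_le ih fun r hr => ?_
      have hw : r ∈ symWeight F (n + 2) :=
        Submodule.span_le.2 (relGenerators_subset F (n + 2) _) hr.1
      rw [Submodule.mem_comap, symTrunc_eq_self hw]
      refine le_iSup (fun n => relLE n F) (n + 2) ?_
      rw [relLE.eq_def (n + 2)]
      exact Submodule.mem_sup_right hr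

/-- The projection of `𝓛(F)` to `𝓛_{≥2}(F)` along the component of weight one. -/
def trunc (F : Type u) [Field F] : L F →ₗ[ℚ] L F :=
  (rel F).mapQ (rel F) (symTrunc F) (rel_le_comap_symTrunc F)

/-- The truncated cobracket: the cobracket without its components that involve weight one. -/
def truncCobracket (F : Type u) [Field F] : L F →ₗ[ℚ] L F ⊗[ℚ] L F :=
  TensorProduct.map (trunc F) (trunc F) ∘ₗ cobracket F

/-! ### Multiple polylogarithms and the depth filtration -/

/-- The class in `𝓛(F)` of the formal iterated integral `I(0; x₁, …, xₙ; xₙ₊₁)`, which is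
`Cor(x₁, …, xₙ₊₁) - Cor(0, x₁, …, xₙ)`. -/
def iterInt {F : Type u} [Field F] (w : List F) : L F :=
  (rel F).mkQ (cor w - cor (0 :: w.dropLast))

/-- For `l = [(n₁, a₁), …, (n_k, a_k)]`, the word
`p, 0^{n₁-1}, p a₁, 0^{n₂-1}, p a₁ a₂, …, 0^{n_k-1}, p a₁ ⋯ a_k`. -/
def polylogWord {F : Type u} [Field F] : F → List (ℕ+ × Fˣ) → List F
  | p, [] => [p]
  | p, (n, a) :: l => p :: (List.replicate ((n : ℕ) - 1) 0 ++ polylogWord (p * a) l)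

/-- For `l = [(n₁, a₁), …, (n_k, a_k)]`, the formal multiple polylogarithm
`Li_{n₀; n₁, …, n_k}(a₁, …, a_k)`, which is
`(-1)^k I(0; 0^{n₀}, 1, 0^{n₁-1}, a₁, 0^{n₂-1}, a₁ a₂, …, 0^{n_k-1}; a₁ ⋯ a_k)`. For `n₀ = 0` it
corresponds to the series `∑_{0<m₁<⋯<m_k} ∏ aᵢ^{mᵢ} / mᵢ^{nᵢ}`. -/
def polylog {F : Type u} [Field F] (n₀ : ℕ) (l : List (ℕ+ × Fˣ)) : L F :=
  (-1 : ℚ) ^ l.length • iterInt (List.replicate n₀ 0 ++ polylogWord 1 l)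

/-- The weight `n₀ + n₁ + ⋯ + n_k`. -/
def polylogWeight {F : Type u} [Field F] (n₀ : ℕ) (l : List (ℕ+ × Fˣ)) : ℕ :=
  n₀ + (l.map fun x => (x.1 : ℕ)).sum

/-- The step `𝓓_d 𝓛_{≥2}(F)` of the depth filtration: the span of the multiple polylogarithms of
weight at least two and depth at most `d`. -/
def depthFiltration (F : Type u) [Field F] (d : ℕ) : Submodule ℚ (L F) :=
  Submodule.span ℚ {x | ∃ (n₀ : ℕ) (l : List (ℕ+ × Fˣ)), 1 ≤ l.length ∧ l.length ≤ d ∧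
    2 ≤ polylogWeight n₀ l ∧ x = polylog n₀ l}

/-- The associated graded space `gr_d 𝓛_{≥2}(F) = 𝓓_d 𝓛_{≥2}(F) / 𝓓_{d-1} 𝓛_{≥2}(F)`, for
`d ≥ 1`. -/
abbrev depthGraded (F : Type u) [Field F] (d : ℕ) : Type u :=
  depthFiltration F d ⧸ (depthFiltration F (d - 1)).submoduleOf (depthFiltration F d)

/-- The space `𝓑_n(F)` of classical polylogarithms of weight `n`, spanned by all `Li_n(a)`. -/
def classical (F : Type u) [Field F] (n : ℕ+) : Submodule ℚ (L F) :=
  Submodule.span ℚ (Set.range fun a : Fˣ => polylog 0 [(n, a)])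

/-- The space `⨁_{n ≥ 2} 𝓑_n(F)`, inside `𝓛(F)`. The sum is direct, because the summands have
different weights. -/
def classicalSum (F : Type u) [Field F] : Submodule ℚ (L F) :=
  ⨆ (n : ℕ+) (_ : 2 ≤ n), classical F n

/-! ### The cofree Lie coalgebra -/

/-- The list of all shuffles of two words. -/
def shuffles {α : Type u} : List α → List α → List (List α)
  | [], v => [v]
  | a :: u, [] => [a :: u]
  | a :: u, b :: v =>
    (shuffles u (b :: v)).map (a :: ·) ++ (shuffles (a :: u) v).map (b :: ·)
  termination_by u v => u.length + v.length

section CoLie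

variable (V : Type u) [AddCommGroup V] [Module ℚ V]

/-- The tensor `v₁ ⊗ ⋯ ⊗ v_k` in the tensor algebra. -/
def tensorWord {V : Type u} [AddCommGroup V] [Module ℚ V] (l : List V) : TensorAlgebra ℚ V :=
  (l.map (TensorAlgebra.ι ℚ)).prod

/-- The span of the shuffle products of tensors of positive degree. -/
def shuffleSpan : Submodule ℚ (TensorAlgebra ℚ V) :=
  Submodule.span ℚ {x | ∃ u v : List V, u ≠ [] ∧ v ≠ [] ∧
    x = ((shuffles u v).map tensorWord).sum}

/-- The quotient of the tensor coalgebra on `V` by shuffle products. Its part of positive degree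
is the cofree (conilpotent) Lie coalgebra cogenerated by `V`, the cobracket being induced by
antisymmetrized deconcatenation. -/
abbrev CoLieTotal : Type u := TensorAlgebra ℚ V ⧸ shuffleSpan V

/-- The component `coLie_d(V)` of degree `d ≥ 1` of the cofree Lie coalgebra, that is
`V^{⊗ d}` modulo shuffle products. -/
def coLie (d : ℕ) : Submodule ℚ (CoLieTotal V) :=
  ((LinearMap.range (TensorAlgebra.ι ℚ (M := V))) ^ d).map (shuffleSpan V).mkQ

end CoLie

/-- The algebra map between tensor algebras induced by a linear map. -/
def tensorMap {V W : Type u} [AddCommGroup V] [Module ℚ V] [AddCommGroup W] [Module ℚ W]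
    (f : V →ₗ[ℚ] W) : TensorAlgebra ℚ V →ₐ[ℚ] TensorAlgebra ℚ W :=
  TensorAlgebra.lift ℚ (TensorAlgebra.ι ℚ ∘ₗ f)

lemma tensorMap_tensorWord {V W : Type u} [AddCommGroup V] [Module ℚ V] [AddCommGroup W]
    [Module ℚ W] (f : V →ₗ[ℚ] W) (l : List V) :
    tensorMap f (tensorWord l) = tensorWord (l.map f) := by
  unfold tensorWord tensorMap
  rw [map_list_prod, List.map_map, List.map_map]
  congr 1
  refine List.map_congr_left fun x _ => ?_
  simp

lemma shuffles_map {α β : Type u} (f : α → β) (u v : List α) :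
    shuffles (u.map f) (v.map f) = (shuffles u v).map (List.map f) := by
  induction u, v using shuffles.induct with
  | case1 v => simp [shuffles]
  | case2 a u => simp [shuffles]
  | case3 a u b v ih1 ih2 =>
    simp only [List.map_cons] at ih1 ih2
    simp [shuffles, ih1, ih2, Function.comp_def]

lemma shuffleSpan_le_comap {V W : Type u} [AddCommGroup V] [Module ℚ V] [AddCommGroup W]
    [Module ℚ W] (f : V →ₗ[ℚ] W) :
    shuffleSpan V ≤ (shuffleSpan W).comap (tensorMap f).toLinearMap := by
  refine Submodule.span_le.2 ?_
  rintro _ ⟨u, v, hu, hv, rfl⟩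
  refine Submodule.subset_span ⟨u.map f, v.map f, by simpa using hu, by simpa using hv, ?_⟩
  rw [shuffles_map, AlgHom.toLinearMap_apply, map_list_sum, List.map_map, List.map_map]
  congr 1
  exact List.map_congr_left fun x _ => tensorMap_tensorWord f x

/-- The map between cofree Lie coalgebras induced by a linear map. -/
def coLieMap {V W : Type u} [AddCommGroup V] [Module ℚ V] [AddCommGroup W] [Module ℚ W]
    (f : V →ₗ[ℚ] W) : CoLieTotal V →ₗ[ℚ] CoLieTotal W :=
  (shuffleSpan V).mapQ (shuffleSpan W) (tensorMap f).toLinearMap (shuffleSpan_le_comap f)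

/-! ### The iterated truncated cobracket -/

/-- The `k`-fold iteration `(id ⊗ ⋯ ⊗ id ⊗ δ) ∘ ⋯ ∘ (id ⊗ δ) ∘ δ` of a map `δ : V → V ⊗ V`, with
values in `V^{⊗ (k+1)}`. -/
def tensorIterate {V : Type u} [AddCommGroup V] [Module ℚ V] (δ : V →ₗ[ℚ] V ⊗[ℚ] V) :
    ℕ → V →ₗ[ℚ] TensorAlgebra ℚ V
  | 0 => TensorAlgebra.ι ℚ
  | k + 1 => LinearMap.mul' ℚ (TensorAlgebra ℚ V) ∘ₗ
      TensorProduct.map (TensorAlgebra.ι ℚ) (tensorIterate δ k) ∘ₗ δ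

/-- The iterated cobracket `δ^{[k]} : V → coLie_{k+1}(V)` of a Lie coalgebra `(V, δ)`, the
component of degree `k + 1` of the canonical map to the cofree Lie coalgebra: its pairing with a
Lie polynomial `[y₁, [y₂, …, [y_k, y_{k+1}]]]` is the pairing of `tensorIterate δ k` with
`y₁ ⊗ ⋯ ⊗ y_{k+1}`. By the Dynkin-Specht-Wever theorem it is the class of `tensorIterate δ k`
divided by `k + 1`. For instance, if `δ x` is the sum of the tensors `aᵢ ⊗ bᵢ - bᵢ ⊗ aᵢ`, then
`δ^{[1]} x` is the sum of the classes of `aᵢ ⊗ bᵢ`. -/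
def iteratedCobracket {V : Type u} [AddCommGroup V] [Module ℚ V] (δ : V →ₗ[ℚ] V ⊗[ℚ] V) (k : ℕ) :
    V →ₗ[ℚ] CoLieTotal V :=
  ((k : ℚ) + 1)⁻¹ • ((shuffleSpan V).mkQ ∘ₗ tensorIterate δ k)

/-- The map `φ` from `gr_d 𝓛_{≥2}(F)` to `coLie_d(⨁_{n ≥ 2} 𝓑_n(F))` is the one induced by the
iterated truncated cobracket with index `d - 1`. -/
def IsInducedByTruncCobracket (F : Type u) [Field F] (d : ℕ)
    (φ : depthGraded F d →ₗ[ℚ] coLie (classicalSum F) d) : Prop :=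
  ∀ x : depthFiltration F d,
    coLieMap (classicalSum F).subtype (φ (Submodule.Quotient.mk x)) =
      iteratedCobracket (truncCobracket F) (d - 1) (x : L F)

end Polylog

end

/-!
The truncated cobracket respects depth: up to cyclic rotation and affine transformations, every
correlator that contains a letter `c` and `m + 1` letters different from `c` is a combination of
multiple polylogarithms of depth at most `m` (`gam_mem`), and both parts of a cut share a letter,
so that the depths of the two parts add up to at most the depth of the whole
(`truncCobracket_mem`). The part of depth zero vanishes in weight at least two, and the part of
depth one consists of classical polylogarithms (`depthFiltration_one_le`). Hence the `(d-1)`-fold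
iteration kills depth `d - 1` and maps depth `d` to tensors of classical polylogarithms; it
induces a map to `coLie_d` of the latter, which is unique because the classical polylogarithms
have a linear complement in `𝓛(F)`.

For surjectivity, take the correlators `Cor(0^k, x₀, …, x_d)` with all zeros in one block. Modulo
smaller depth their truncated cobracket is antisymmetrized deconcatenation of the letters
`xᵢ₊₁ / xᵢ` (`truncCobracket_block`). Its iteration is therefore the adjoint of iterated
bracketing, applied to products of the generating series `∑_p Li_{p+1}(aᵢ) t^p` (up to sign)
(`tensorIterate_block`), and modulo shuffle products this is multiplication by `d`
(`dyn_sub_mem_shuffleSpan`), since adjoint bracketing is the convolution of the degree operator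
with the antipode. This only gives sums over all distributions of the weight among the `d`
factors. The distribution relation `Li_{p+1}(b²) = 2^p (Li_{p+1}(b) + Li_{p+1}(-b))` separates
them: as every `a` is a square, the span of the generating series is stable under `t ↦ t / 2`, and
interpolation in this operator isolates one weight in each factor (`exists_isolated`).

The relations used (cyclic and affine invariance, the relation between depth one words, and the
distribution relation) are proved by deformation (`mem_relLE_of_deformation`): the combination is
put into a family over `F(t)` with vanishing cobracket, which specializes to degenerate words at
another point.
-/

noncomputable section

namespace Polylog

universe u

/-! ### Wedges and cyclic sums -/

section Wedge
variable {V W : Type u} [AddCommGroup V] [Module ℚ V] [AddCommGroup W] [Module ℚ W]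

/-- The wedge as a bilinear map. -/
def wedgeLin (V : Type u) [AddCommGroup V] [Module ℚ V] : V →ₗ[ℚ] V →ₗ[ℚ] V ⊗[ℚ] V :=
  TensorProduct.mk ℚ V V - (TensorProduct.mk ℚ V V).flip

lemma wedge_eq (a b : V) : wedge a b = wedgeLin V a b := rfl

@[simp] lemma wedge_self (a : V) : wedge a a = 0 := sub_self _

@[simp] lemma wedge_zero_left (a : V) : wedge 0 a = 0 := by simp [wedge_eq]

@[simp] lemma wedge_zero_right (a : V) : wedge a 0 = 0 := by simp [wedge_eq]

lemma wedge_swap (a b : V) : wedge b a = -wedge a b := by simp [wedge]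

lemma wedge_add_left (a b c : V) : wedge (a + b) c = wedge a c + wedge b c := by simp [wedge_eq]

lemma wedge_add_right (a b c : V) : wedge a (b + c) = wedge a b + wedge a c := by simp [wedge_eq]

@[simp] lemma wedge_neg_right (a b : V) : wedge a (-b) = -wedge a b := by simp [wedge_eq]

lemma tensor_neg_smul (r : ℚ) (x : V ⊗[ℚ] V) : (-r) • x = -(r • x) := neg_smul r x

lemma wedge_sub_right (a b c : V) : wedge a (b - c) = wedge a b - wedge a c := by simp [wedge_eq]

lemma wedge_smul_left (r : ℚ) (a b : V) : wedge (r • a) b = r • wedge a b := by simp [wedge_eq]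

lemma wedge_smul_right (r : ℚ) (a b : V) : wedge a (r • b) = r • wedge a b := by simp [wedge_eq]

lemma map_wedge (f : V →ₗ[ℚ] W) (a b : V) :
    TensorProduct.map f f (wedge a b) = wedge (f a) (f b) := by simp [wedge]

end Wedge

/-- A sum over all rotations of a word does not change when the word is rotated. -/
lemma sum_rotate_succ {α : Type*} {M : Type*} [AddCommGroup M] (g : List α → M) (w : List α) :
    ∑ i ∈ Finset.range w.length, g (w.rotate (i + 1)) =
      ∑ i ∈ Finset.range w.length, g (w.rotate i) := by
  have h1 := Finset.sum_range_succ (fun i => g (w.rotate i)) w.length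
  have h2 := Finset.sum_range_succ' (fun i => g (w.rotate i)) w.length
  rw [h1] at h2
  simp only [List.rotate_length, List.rotate_zero] at h2
  exact (add_right_cancel h2).symm

section Cut
variable {α V : Type u} [AddCommGroup V] [Module ℚ V]

/-- The part of the cobracket of the cyclic word `v` given by the cuts that start at the first
letter of `v`; `f` is the value of correlators. -/
def cutSum (f : List α → V) (v : List α) : V ⊗[ℚ] V :=
  ∑ j ∈ Finset.Ico 1 (v.length - 1), wedge (f (v.take (j + 1))) (f (v.take 1 ++ v.drop (j + 1)))

/-- The sum over all cuts of the cyclic word `w`, where `f` is the value of correlators. -/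
def cyclicCut (f : List α → V) (w : List α) : V ⊗[ℚ] V :=
  ∑ i ∈ Finset.range w.length, cutSum f (w.rotate i)

lemma cyclicCut_rotate_one (f : List α → V) (w : List α) :
    cyclicCut f (w.rotate 1) = cyclicCut f w := by
  unfold cyclicCut
  rw [← sum_rotate_succ (cutSum f) w, List.length_rotate]
  simp [List.rotate_rotate, add_comm]

lemma map_symCobracket_cor {F : Type u} (f : Sym F →ₗ[ℚ] V) (w : List F) :
    TensorProduct.map f f (symCobracket F (cor w)) = cyclicCut (fun v => f (cor v)) w := by
  simp only [symCobracket, cor, Finsupp.linearCombination_single, one_smul, symCobracketWord,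
    map_sum, map_wedge, cyclicCut, cutSum, List.length_rotate]

end Cut

lemma symCobracketMod_cor {F : Type u} (N : Submodule ℚ (Sym F)) (w : List F) :
    symCobracketMod N (cor w) = cyclicCut (fun v => N.mkQ (cor v)) w :=
  map_symCobracket_cor N.mkQ w

lemma linearCombination_cor {F : Type u} {W : Type*} [AddCommGroup W] [Module ℚ W] (f : List F → W)
    (w : List F) : Finsupp.linearCombination ℚ f (cor w) = f w := by
  simp [cor]

/-! ### Logarithms -/

section Relations
variable {F : Type u} [Field F]

lemma relLE_mono {m n : ℕ} (h : m ≤ n) : relLE m F ≤ relLE n F :=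
  monotone_nat_of_le_succ (f := fun n => relLE n F) (fun n => relLE_mono_succ n F) h

lemma relLE_le_rel (n : ℕ) : relLE n F ≤ rel F := le_iSup (fun n => relLE n F) n

/-- The class of a correlator modulo the relations of weight at most `m`. -/
def corMod (m : ℕ) (w : List F) : Sym F ⧸ relLE m F := (relLE m F).mkQ (cor w)

/-- The class of `Cor(a, 0)`, the logarithm of `a` (with `log 0 = 0`). -/
def logMod (m : ℕ) (a : F) : Sym F ⧸ relLE m F := corMod m [a, 0]

lemma corMod_eq_iff {m : ℕ} {v w : List F} :
    corMod m v = corMod m w ↔ cor v - cor w ∈ relLE m F := by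
  simp only [corMod, Submodule.mkQ_apply]
  exact Submodule.Quotient.eq _

lemma corMod_eq_zero_iff {m : ℕ} {w : List F} : corMod m w = 0 ↔ cor w ∈ relLE m F := by
  simp [corMod]

lemma corMod_eq_zero_of_length_le {m : ℕ} {w : List F} (h : w.length ≤ 1) : corMod m w = 0 :=
  corMod_eq_zero_iff.2 <| relLE_mono (Nat.zero_le m) <| by
    rw [relLE]; exact Finsupp.single_mem_supported ℚ 1 h

lemma mem_relLE_of_log {m : ℕ} (hm : 1 ≤ m) {r : Sym F} (hr : r ∈ symWeight F 1)
    (h : Finsupp.linearCombination ℚ (logWord (F := F)) r = 0) : r ∈ relLE m F := by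
  refine relLE_mono hm ?_
  rw [relLE]
  exact Submodule.mem_sup_right ⟨hr, h⟩

lemma corMod_pair {m : ℕ} (hm : 1 ≤ m) (x y : F) : corMod m [x, y] = logMod m (x - y) := by
  refine corMod_eq_iff.2 (mem_relLE_of_log hm (Submodule.sub_mem _ (cor_mem_symWeight rfl)
    (cor_mem_symWeight rfl)) ?_)
  rw [map_sub, linearCombination_cor, linearCombination_cor]
  by_cases h : x - y = 0 <;> simp [logWord, h]

lemma logMod_zero {m : ℕ} (hm : 1 ≤ m) : logMod m (0 : F) = 0 := by
  refine corMod_eq_zero_iff.2 (mem_relLE_of_log hm (cor_mem_symWeight rfl) ?_)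
  rw [linearCombination_cor]
  simp [logWord]

lemma logMod_mul {m : ℕ} (hm : 1 ≤ m) {a b : F} (ha : a ≠ 0) (hb : b ≠ 0) :
    logMod m (a * b) = logMod m a + logMod m b := by
  rw [← sub_eq_zero, ← sub_sub]
  have : cor [a * b, 0] - cor [a, 0] - cor [b, 0] ∈ relLE m F := by
    refine mem_relLE_of_log hm (Submodule.sub_mem _ (Submodule.sub_mem _ (cor_mem_symWeight rfl)
      (cor_mem_symWeight rfl)) (cor_mem_symWeight rfl)) ?_
    rw [map_sub, map_sub, linearCombination_cor, linearCombination_cor, linearCombination_cor]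
    simp only [logWord, sub_zero, ne_eq, mul_eq_zero, ha, hb, or_self, not_false_eq_true,
      dite_true, Units.mk0_mul, ofMul_mul, TensorProduct.tmul_add]
    abel
  simpa [logMod, corMod] using (Submodule.Quotient.mk_eq_zero _).2 this

lemma logMod_one {m : ℕ} (hm : 1 ≤ m) : logMod m (1 : F) = 0 := by
  have := logMod_mul hm (one_ne_zero (α := F)) one_ne_zero
  rw [mul_one] at this
  exact left_eq_add.1 this

lemma logMod_neg_one {m : ℕ} (hm : 1 ≤ m) : logMod m (-1 : F) = 0 := by
  have := logMod_mul hm (neg_ne_zero.2 (one_ne_zero (α := F))) (neg_ne_zero.2 one_ne_zero)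
  rw [neg_mul_neg, mul_one, logMod_one hm, ← two_smul ℚ] at this
  exact (smul_eq_zero.1 this.symm).resolve_left two_ne_zero

lemma logMod_neg {m : ℕ} (hm : 1 ≤ m) (a : F) : logMod m (-a) = logMod m a := by
  by_cases ha : a = 0
  · simp [ha]
  · rw [← neg_one_mul, logMod_mul hm (neg_ne_zero.2 one_ne_zero) ha, logMod_neg_one hm, zero_add]

end Relations

/-! ### Specialization and deformation -/

section Specialization
variable {F : Type u} [Field F]
open Polynomial

/-- The rational function `x` is regular at `a`, with value `y`. -/
def HasValueAt (a : F) (x : RatFunc F) (y : F) : Prop :=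
  ∃ p q : F[X], x * algebraMap F[X] (RatFunc F) q = algebraMap F[X] (RatFunc F) p ∧
    q.eval a ≠ 0 ∧ p.eval a = y * q.eval a

lemma hasValueAt_iff {a : F} {x : RatFunc F} {y : F} :
    HasValueAt a x y ↔ x.denom.eval a ≠ 0 ∧ x.eval (RingHom.id F) a = y := by
  have hx : x * algebraMap F[X] (RatFunc F) x.denom = algebraMap F[X] (RatFunc F) x.num := by
    have h := RatFunc.num_div_denom x
    rwa [div_eq_iff (RatFunc.algebraMap_ne_zero (RatFunc.denom_ne_zero x)), eq_comm] at h
  constructor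
  · rintro ⟨p, q, h, hq, hp⟩
    have h1 : x.num * q = p * x.denom := by
      apply RatFunc.algebraMap_injective F
      rw [map_mul, map_mul, ← hx, ← h]; ring
    have h2 : x.denom ∣ q :=
      (RatFunc.isCoprime_num_denom x).symm.dvd_of_dvd_mul_left ⟨p, by rw [h1, mul_comm]⟩
    have h3 : x.denom.eval a ≠ 0 := by
      obtain ⟨r, rfl⟩ := h2
      rw [eval_mul] at hq
      exact left_ne_zero_of_mul hq
    refine ⟨h3, ?_⟩
    have h4 := congrArg (Polynomial.eval a) h1
    rw [eval_mul, eval_mul, hp] at h4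
    rw [RatFunc.eval, eval₂_id, eval₂_id, div_eq_iff h3]
    apply mul_right_cancel₀ hq
    rw [h4]; ring
  · rintro ⟨h, rfl⟩
    refine ⟨x.num, x.denom, hx, h, ?_⟩
    rw [RatFunc.eval, eval₂_id, eval₂_id, div_mul_cancel₀ _ h]

lemma HasValueAt.add {a : F} {x x' : RatFunc F} {y y' : F} (h : HasValueAt a x y)
    (h' : HasValueAt a x' y') : HasValueAt a (x + x') (y + y') := by
  obtain ⟨p, q, h1, h2, h3⟩ := h
  obtain ⟨p', q', h1', h2', h3'⟩ := h'
  refine ⟨p * q' + p' * q, q * q', ?_, ?_, ?_⟩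
  · rw [map_mul, map_add, map_mul, map_mul, ← h1, ← h1']; ring
  · rw [eval_mul]; exact mul_ne_zero h2 h2'
  · simp only [eval_mul, eval_add, h3, h3']; ring

lemma HasValueAt.mul {a : F} {x x' : RatFunc F} {y y' : F} (h : HasValueAt a x y)
    (h' : HasValueAt a x' y') : HasValueAt a (x * x') (y * y') := by
  obtain ⟨p, q, h1, h2, h3⟩ := h
  obtain ⟨p', q', h1', h2', h3'⟩ := h'
  refine ⟨p * p', q * q', ?_, ?_, ?_⟩
  · rw [map_mul, map_mul, ← h1, ← h1']; ring
  · rw [eval_mul]; exact mul_ne_zero h2 h2'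
  · simp only [eval_mul, h3, h3']; ring

lemma HasValueAt.neg {a : F} {x : RatFunc F} {y : F} (h : HasValueAt a x y) :
    HasValueAt a (-x) (-y) := by
  obtain ⟨p, q, h1, h2, h3⟩ := h
  exact ⟨-p, q, by rw [map_neg, ← h1, neg_mul], h2, by rw [eval_neg, h3, neg_mul]⟩

lemma HasValueAt.sub {a : F} {x x' : RatFunc F} {y y' : F} (h : HasValueAt a x y)
    (h' : HasValueAt a x' y') : HasValueAt a (x - x') (y - y') := by
  rw [sub_eq_add_neg, sub_eq_add_neg]; exact h.add h'.neg

lemma HasValueAt.inv {a : F} {x : RatFunc F} {y : F} (h : HasValueAt a x y) (hy : y ≠ 0) :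
    HasValueAt a x⁻¹ y⁻¹ := by
  obtain ⟨p, q, h1, h2, h3⟩ := h
  have hp : p.eval a ≠ 0 := by rw [h3]; exact mul_ne_zero hy h2
  have hx : x ≠ 0 := by
    rintro rfl
    rw [zero_mul, eq_comm, map_eq_zero_iff _ (RatFunc.algebraMap_injective F)] at h1
    simp [h1] at hp
  refine ⟨q, p, ?_, hp, ?_⟩
  · rw [← h1, inv_mul_cancel_left₀ hx]
  · rw [h3, inv_mul_cancel_left₀ hy]

lemma HasValueAt.unique {a : F} {x : RatFunc F} {y y' : F} (h : HasValueAt a x y)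
    (h' : HasValueAt a x y') : y = y' :=
  (hasValueAt_iff.1 h).2.symm.trans (hasValueAt_iff.1 h').2

lemma hasValueAt_algebraMap (a : F) (p : F[X]) :
    HasValueAt a (algebraMap F[X] (RatFunc F) p) (p.eval a) :=
  ⟨p, 1, by simp, by simp, by simp⟩

/-- Two specializations of the same word differ by an affine transformation. -/
lemma IsSpecialization.affine {a : F} {w : List (RatFunc F)} {v v' : List F}
    (h : IsSpecialization a w v) (h' : IsSpecialization a w v') :
    ∃ c b : F, c ≠ 0 ∧ v' = v.map fun x => c * x + b := by
  have key : ∀ v : List F, IsSpecialization a w v → ∃ (c b : RatFunc F) (f : RatFunc F → F),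
      c ≠ 0 ∧ v = w.map f ∧ (∀ x ∈ w, HasValueAt a (c * x + b) (f x)) ∧
      ∃ x ∈ w, ∃ z ∈ w, f x ≠ f z := by
    clear h h'
    rintro v ⟨⟨c, b, hc, hf⟩, y, hy, z, hz, hyz⟩
    have hv : v = w.map fun x => (c * x + b).eval (RingHom.id F) a := by
      clear hy hz
      induction hf with
      | nil => rfl
      | cons h _ ih => rw [List.map_cons, ← ih, h.2]
    refine ⟨c, b, _, hc, hv, fun x hx => ?_, ?_⟩
    · refine hasValueAt_iff.2 ⟨?_, rfl⟩
      clear hy hz hv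
      induction hf with
      | nil => simp at hx
      | cons h _ ih =>
        rcases List.mem_cons.1 hx with rfl | hx
        · exact h.1
        · exact ih hx
    · rw [hv, List.mem_map] at hy hz
      obtain ⟨x, hx, rfl⟩ := hy
      obtain ⟨x', hx', rfl⟩ := hz
      exact ⟨x, hx, x', hx', hyz⟩
  obtain ⟨c, b, f, hc, rfl, hf, x₀, h₀, x₁, h₁, hne⟩ := key v h
  obtain ⟨c', b', f', hc', rfl, hf', x₂, h₂, x₃, h₃, hne'⟩ := key v' h'
  -- the affine map over `F(t)` relating the two normalizations is regular at `a`
  have hα : HasValueAt a (c' / c) ((f' x₀ - f' x₁) / (f x₀ - f x₁)) := by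
    have hd := (hf x₀ h₀).sub (hf x₁ h₁)
    have hd' := (hf' x₀ h₀).sub (hf' x₁ h₁)
    have hx : x₀ ≠ x₁ := by rintro rfl; exact hne rfl
    have := hd'.mul (hd.inv (sub_ne_zero.2 hne))
    have e : (c' * x₀ + b' - (c' * x₁ + b')) * (c * x₀ + b - (c * x₁ + b))⁻¹ = c' / c := by
      have : x₀ - x₁ ≠ 0 := sub_ne_zero.2 hx
      rw [show c' * x₀ + b' - (c' * x₁ + b') = c' * (x₀ - x₁) by ring,
        show c * x₀ + b - (c * x₁ + b) = c * (x₀ - x₁) by ring]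
      field_simp
    rwa [e, ← div_eq_mul_inv] at this
  set C := (f' x₀ - f' x₁) / (f x₀ - f x₁)
  have hβ := (hf' x₀ h₀).sub (hα.mul (hf x₀ h₀))
  have hval : ∀ x ∈ w, f' x = C * f x + (f' x₀ - C * f x₀) := by
    intro x hx
    refine (hf' x hx).unique ?_
    have := (hα.mul (hf x hx)).add hβ
    convert this using 1
    field_simp
    ring
  refine ⟨C, f' x₀ - C * f x₀, ?_, ?_⟩
  · intro h0
    apply hne'
    rw [hval x₂ h₂, hval x₃ h₃, h0]; ring
  · rw [List.map_map]
    exact List.map_congr_left hval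

/-- The span of the generators of the relations of weight `n + 2`. -/
abbrev relSpan (F : Type u) [Field F] (n : ℕ) : Submodule ℚ (Sym F) :=
  Submodule.span ℚ (relGenerators F (n + 2) (relLE (n + 1) (RatFunc F)))

lemma mem_relLE_of_mem_relSpan {n : ℕ} {r : Sym F} (h : r ∈ relSpan F n)
    (h' : symCobracketMod (relLE (n + 1) F) r = 0) : r ∈ relLE (n + 2) F := by
  rw [relLE]
  exact Submodule.mem_sup_right ⟨h, h'⟩

/-- The word of values at `a` of a word of polynomials. -/
def evalWord (a : F) (w : List F[X]) : List F := w.map (eval a)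

/-- A word of polynomials as a word of rational functions. -/
def ratWord (w : List F[X]) : List (RatFunc F) := w.map (algebraMap F[X] (RatFunc F))

lemma isSpecialization_ratWord {a : F} {w : List F[X]}
    (h : ∃ y ∈ evalWord a w, ∃ z ∈ evalWord a w, y ≠ z) :
    IsSpecialization a (ratWord w) (evalWord a w) := by
  refine ⟨⟨1, 0, one_ne_zero, ?_⟩, h⟩
  rw [ratWord, evalWord, List.forall₂_map_left_iff, List.forall₂_map_right_iff, List.forall₂_same]
  intro p _
  rw [one_mul, add_zero]
  exact hasValueAt_iff.1 (hasValueAt_algebraMap a p)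

lemma specialize_ratWord_sub_mem {n : ℕ} {a : F} {w : List F[X]} (hw : w.length = n + 3)
    (h : ∃ y ∈ evalWord a w, ∃ z ∈ evalWord a w, y ≠ z) :
    specialize a (cor (ratWord w)) - cor (evalWord a w) ∈ relSpan F n := by
  have hs := isSpecialization_ratWord h
  have hex : ∃ v, IsSpecialization a (ratWord w) v := ⟨_, hs⟩
  obtain ⟨c, b, hc, hv⟩ := hs.affine hex.choose_spec
  rw [specialize, linearCombination_cor, specializeWord, dif_pos hex, hv]
  exact Submodule.subset_span (Or.inl (Or.inr
    ⟨evalWord a w, c, b, by simpa [evalWord] using hw, hc, rfl⟩))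

/-- A combination of correlators vanishes if it is the value at `t = a` of a family whose
cobracket vanishes and which degenerates at `t = b`. -/
lemma mem_relLE_of_deformation {n : ℕ} (a b : F) {ι : Type*} [Fintype ι] (k : ι → ℚ)
    (w : ι → List F[X]) (hlen : ∀ i, (w i).length = n + 3)
    (ha : ∀ i, ∃ y ∈ evalWord a (w i), ∃ z ∈ evalWord a (w i), y ≠ z)
    (hb : ∀ i, ∃ y ∈ evalWord b (w i), ∃ z ∈ evalWord b (w i), y ≠ z)
    (hdeg : ∀ i, IsDegenerate (evalWord b (w i)))
    (ht : symCobracketMod (relLE (n + 1) (RatFunc F)) (∑ i, k i • cor (ratWord (w i))) = 0)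
    (hF : symCobracketMod (relLE (n + 1) F) (∑ i, k i • cor (evalWord a (w i))) = 0) :
    ∑ i, k i • cor (evalWord a (w i)) ∈ relLE (n + 2) F := by
  refine mem_relLE_of_mem_relSpan ?_ hF
  set Ξ := ∑ i, k i • cor (ratWord (w i)) with hΞ
  have hsp : ∀ c : F, (∀ i, ∃ y ∈ evalWord c (w i), ∃ z ∈ evalWord c (w i), y ≠ z) →
      specialize c Ξ - ∑ i, k i • cor (evalWord c (w i)) ∈ relSpan F n := by
    intro c hc
    simp only [hΞ, map_sum, map_smul]
    rw [← Finset.sum_sub_distrib]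
    refine Submodule.sum_mem _ fun i _ => ?_
    rw [← smul_sub]
    exact Submodule.smul_mem _ _ (specialize_ratWord_sub_mem (hlen i) (hc i))
  have hΞw : Ξ ∈ symWeight (RatFunc F) (n + 2) :=
    Submodule.sum_mem _ fun i _ => Submodule.smul_mem _ _ (cor_mem_symWeight (by
      simpa [ratWord] using hlen i))
  have hab : specialize a Ξ - specialize b Ξ ∈ relSpan F n :=
    Submodule.subset_span (Or.inr ⟨Ξ, a, b, hΞw, ht, rfl⟩)
  have hbz : ∑ i, k i • cor (evalWord b (w i)) ∈ relSpan F n :=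
    Submodule.sum_mem _ fun i _ => Submodule.smul_mem _ _ (Submodule.subset_span
      (Or.inl (Or.inl ⟨_, by simpa [evalWord] using hlen i, hdeg i, rfl⟩)))
  have := Submodule.add_mem _ (Submodule.sub_mem _ hab (hsp a ha))
    (Submodule.add_mem _ (hsp b hb) hbz)
  convert this using 1
  abel

end Specialization

/-! ### Counting letters -/

section OffCount
variable {α β : Type u}

open Classical in
/-- The number of letters of the word `w` that differ from `c`. -/
def offCount (c : α) (w : List α) : ℕ := w.countP fun x => decide (x ≠ c)

@[simp] lemma offCount_nil (c : α) : offCount c [] = 0 := rfl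

lemma offCount_cons_self (c : α) (w : List α) : offCount c (c :: w) = offCount c w := by
  simp [offCount]

lemma offCount_cons_of_ne {c x : α} (h : x ≠ c) (w : List α) :
    offCount c (x :: w) = offCount c w + 1 := by
  simp [offCount, h]

@[simp] lemma offCount_append (c : α) (v w : List α) :
    offCount c (v ++ w) = offCount c v + offCount c w := by
  simp [offCount]

lemma offCount_cons_le (c x : α) (w : List α) : offCount c (x :: w) ≤ offCount c w + 1 := by
  by_cases h : x = c
  · subst h; rw [offCount_cons_self]; omega
  · rw [offCount_cons_of_ne h]

@[simp] lemma offCount_replicate_self (c : α) (k : ℕ) : offCount c (List.replicate k c) = 0 := by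
  simp [offCount, List.countP_replicate]

lemma offCount_le_length (c : α) (w : List α) : offCount c w ≤ w.length := List.countP_le_length

lemma offCount_perm (c : α) {v w : List α} (h : v.Perm w) : offCount c v = offCount c w :=
  h.countP_eq _

@[simp] lemma offCount_rotate (c : α) (w : List α) (k : ℕ) :
    offCount c (w.rotate k) = offCount c w :=
  offCount_perm c (w.rotate_perm k)

lemma offCount_sublist (c : α) {v w : List α} (h : v.Sublist w) : offCount c v ≤ offCount c w :=
  h.countP_le

lemma offCount_lt_length {c : α} {w : List α} (h : c ∈ w) : offCount c w + 1 ≤ w.length := by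
  obtain ⟨s, t, rfl⟩ := List.append_of_mem h
  rw [offCount_append, offCount_cons_self]
  have := offCount_le_length c s
  have := offCount_le_length c t
  simp; omega

lemma offCount_map {f : α → β} (hf : Function.Injective f) (c : α) (w : List α) :
    offCount (f c) (w.map f) = offCount c w := by
  classical
  simp [offCount, List.countP_map, Function.comp_def, hf.eq_iff]

lemma eq_replicate_of_offCount_eq_zero {c : α} {w : List α} (h : offCount c w = 0) :
    w = List.replicate w.length c := by
  rw [List.eq_replicate_iff]
  refine ⟨rfl, fun x hx => ?_⟩
  have := (List.countP_eq_zero.1 h) x hx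
  simpa using this

lemma isDegenerate_of_offCount {c : α} : ∀ {w : List α}, w ≠ [] → offCount c w ≤ 1 →
    IsDegenerate w := by
  suffices H : ∀ {w : List α}, w ≠ [] → offCount c w ≤ 1 →
      ∃ (x : α) (k l : ℕ), w = List.replicate k c ++ x :: List.replicate l c by
    intro w h h'
    obtain ⟨x, k, l, e⟩ := H h h'
    exact ⟨c, x, k, l, e⟩
  intro w
  induction w with
  | nil => intro h; exact absurd rfl h
  | cons y v ih =>
    intro _ h
    by_cases hy : y = c
    · subst hy
      rw [offCount_cons_self] at h
      by_cases hv : v = []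
      · exact ⟨y, 0, 0, by simp [hv]⟩
      · obtain ⟨x, k, l, rfl⟩ := ih hv h
        exact ⟨x, k + 1, l, by simp [List.replicate_succ]⟩
    · rw [offCount_cons_of_ne hy] at h
      exact ⟨y, 0, v.length, by
        simpa using eq_replicate_of_offCount_eq_zero (by omega : offCount c v = 0)⟩

/-- The two parts of a cut share their first letter. -/
lemma offCount_cut (c x : α) (r : List α) (j : ℕ) :
    offCount c ((x :: r).take (j + 1)) + offCount c ((x :: r).take 1 ++ (x :: r).drop (j + 1)) =
      offCount c (x :: r) + offCount c [x] := by
  have h : offCount c (x :: r) =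
      offCount c ((x :: r).take (j + 1)) + offCount c ((x :: r).drop (j + 1)) := by
    rw [← offCount_append, List.take_append_drop]
  rw [h, offCount_append]
  simp only [List.take_succ_cons, List.take_zero]
  omega

end OffCount

/-! ### Cyclic invariance, degenerate words, affine invariance -/

section Invariance
variable {F : Type u} [Field F]
open Polynomial

lemma corMod_rotate_one {m : ℕ} (hm : 1 ≤ m) {w : List F} (hw : w.length ≤ m + 1) :
    corMod m (w.rotate 1) = corMod m w := by
  obtain h | h | ⟨n, h⟩ : w.length ≤ 1 ∨ w.length = 2 ∨ ∃ n, w.length = n + 3 := by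
    obtain h | h | h : w.length ≤ 1 ∨ w.length = 2 ∨ 3 ≤ w.length := by omega
    · exact Or.inl h
    · exact Or.inr (Or.inl h)
    · exact Or.inr (Or.inr ⟨w.length - 3, by omega⟩)
  · rw [corMod_eq_zero_of_length_le h, corMod_eq_zero_of_length_le (by simpa using h)]
  · obtain ⟨x, y, rfl⟩ := List.length_eq_two.1 h
    simp only [List.rotate_cons_succ, List.rotate_zero, List.cons_append, List.nil_append]
    rw [corMod_pair hm, corMod_pair hm, ← logMod_neg hm, neg_sub]
  · by_cases hne : ∃ y ∈ w, ∃ z ∈ w, y ≠ z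
    · rw [corMod_eq_iff]
      refine relLE_mono (by omega : n + 2 ≤ m) ?_
      obtain ⟨w', x, rfl⟩ : ∃ w' x, w = w' ++ [x] :=
        ⟨w.dropLast, w.getLast (by rintro rfl; simp at h), (List.dropLast_append_getLast _).symm⟩
      obtain ⟨a, v, rfl⟩ : ∃ a v, w' = a :: v := by
        cases w' with
        | nil => simp at h
        | cons a v => exact ⟨a, v, rfl⟩
      -- the linear deformation of the word to `(0, …, 0, 1)`
      set ps : List F[X] := (a :: v).map (fun y => X * C y) ++ [1 + X * (C x - 1)] with hps
      have h1 : evalWord 1 ps = a :: v ++ [x] := by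
        simp [evalWord, hps, Function.comp_def]
      have h0 : evalWord 0 ps = List.replicate (v.length + 1) 0 ++ [1] := by
        simp [evalWord, hps, List.replicate_succ, Function.comp_def]
      have hr : ∀ c : F, evalWord c (ps.rotate 1) = (evalWord c ps).rotate 1 := fun c => by
        simp [evalWord, List.map_rotate]
      have hr' : ratWord (ps.rotate 1) = (ratWord ps).rotate 1 := by
        simp [ratWord, List.map_rotate]
      have hl : v.length = n + 1 := by simpa using h
      have hdeg : ∃ y ∈ evalWord 0 ps, ∃ z ∈ evalWord 0 ps, y ≠ z :=
        ⟨0, by simp [h0], 1, by simp [h0], zero_ne_one⟩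
      have key := mem_relLE_of_deformation (n := n) (1 : F) 0 (ι := Fin 2) ![1, -1]
        ![ps.rotate 1, ps] ?_ ?_ ?_ ?_ ?_ ?_
      · simpa [Fin.sum_univ_two, hr, h1, sub_eq_add_neg] using key
      · simp [Fin.forall_fin_two, hps, hl]
      · simp only [Fin.forall_fin_two, Matrix.cons_val_zero, Matrix.cons_val_one, hr, h1,
          List.mem_rotate]
        exact ⟨hne, hne⟩
      · simp only [Fin.forall_fin_two, Matrix.cons_val_zero, Matrix.cons_val_one, hr,
          List.mem_rotate]
        exact ⟨hdeg, hdeg⟩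
      · have hc : offCount 0 (evalWord 0 ps) ≤ 1 := by
          rw [h0, offCount_append, offCount_replicate_self]
          exact (Nat.zero_add _).le.trans (offCount_le_length _ _)
        simp only [Fin.forall_fin_two, Matrix.cons_val_zero, Matrix.cons_val_one, hr]
        refine ⟨isDegenerate_of_offCount (c := 0) ?_ ?_, isDegenerate_of_offCount ?_ hc⟩
        · intro h; have := congrArg List.length h; simp [h0] at this
        · rwa [offCount_rotate]
        · simp [h0]
      · simp only [Fin.sum_univ_two, Matrix.cons_val_zero, Matrix.cons_val_one, hr', one_smul,
          neg_smul, ← sub_eq_add_neg, map_sub, symCobracketMod_cor, cyclicCut_rotate_one, sub_self]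
      · simp only [Fin.sum_univ_two, Matrix.cons_val_zero, Matrix.cons_val_one, hr, one_smul,
          neg_smul, ← sub_eq_add_neg, map_sub, symCobracketMod_cor, cyclicCut_rotate_one, sub_self]
    · push Not at hne
      have : w = List.replicate w.length (w.head (by rintro rfl; simp at h)) :=
        List.eq_replicate_iff.2 ⟨rfl, fun b hb => hne b hb _ (List.head_mem _)⟩
      rw [this, List.rotate_replicate]

lemma corMod_rotate {m : ℕ} (hm : 1 ≤ m) {w : List F} (hw : w.length ≤ m + 1) (k : ℕ) :
    corMod m (w.rotate k) = corMod m w := by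
  induction k with
  | zero => rw [List.rotate_zero]
  | succ k ih =>
    rw [← List.rotate_rotate, corMod_rotate_one hm (by simpa using hw), ih]

lemma corMod_append_comm {m : ℕ} (hm : 1 ≤ m) (v w : List F) (hw : v.length + w.length ≤ m + 1) :
    corMod m (v ++ w) = corMod m (w ++ v) := by
  rw [← corMod_rotate hm (by simpa using hw) v.length, List.rotate_append_length_eq]

lemma corMod_eq_zero_of_offCount {m : ℕ} {c : F} {w : List F} (hw : 3 ≤ w.length)
    (hm : w.length ≤ m + 1) (h : offCount c w ≤ 1) : corMod m w = 0 := by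
  induction hn : w.length using Nat.strong_induction_on generalizing w m with
  | _ N ih =>
  obtain ⟨n, rfl⟩ : ∃ n, N = n + 3 := ⟨N - 3, by omega⟩
  have hne : w ≠ [] := by rintro rfl; simp at hn
  rw [corMod_eq_zero_iff]
  refine relLE_mono (by omega : n + 2 ≤ m) (mem_relLE_of_mem_relSpan (Submodule.subset_span
    (Or.inl (Or.inl ⟨w, hn, isDegenerate_of_offCount hne h, rfl⟩))) ?_)
  rw [symCobracketMod_cor]
  refine Finset.sum_eq_zero fun i _ => Finset.sum_eq_zero fun j hj => ?_
  rw [List.length_rotate, Finset.mem_Ico] at hj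
  obtain ⟨x, r, hxr⟩ : ∃ x r, w.rotate i = x :: r := by
    cases h : w.rotate i with
    | nil => have := congrArg List.length h; simp [hn] at this
    | cons x r => exact ⟨x, r, rfl⟩
  have hlr : r.length = n + 2 := by
    have := congrArg List.length hxr; simp at this; omega
  have hcut := offCount_cut c x r j
  have hx : offCount c [x] ≤ offCount c (x :: r) :=
    offCount_sublist c (by simp)
  rw [← hxr, offCount_rotate] at hcut hx
  have hA : ((w.rotate i).take (j + 1)).length = j + 1 := by simp; omega
  have hB : ((w.rotate i).take 1 ++ (w.rotate i).drop (j + 1)).length = n + 3 - j := by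
    simp; omega
  have hAB : offCount c ((w.rotate i).take (j + 1)) ≤ 1 ∧
      offCount c ((w.rotate i).take 1 ++ (w.rotate i).drop (j + 1)) ≤ 1 := by
    have h1 : offCount c [x] ≤ offCount c ((w.rotate i).take (j + 1)) := by
      rw [hxr, List.take_succ_cons]; exact offCount_sublist c (by simp)
    have h2 : offCount c [x] ≤
        offCount c ((w.rotate i).take 1 ++ (w.rotate i).drop (j + 1)) := by
      rw [hxr, List.take_succ_cons, List.take_zero, offCount_append]; omega
    omega
  change wedge (corMod (n + 1) _) (corMod (n + 1) _) = 0
  by_cases h3 : 2 ≤ j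
  · rw [ih _ (by omega : j + 1 < n + 3) (by omega) (by omega) hAB.1 hA, wedge_zero_left]
  by_cases h4 : 1 ≤ n
  · rw [ih _ (by omega : n + 3 - j < n + 3) (by omega) (by omega) hAB.2 hB, wedge_zero_right]
  -- weight two: both parts are logarithms
  obtain rfl : j = 1 := by omega
  obtain rfl : n = 0 := by omega
  obtain ⟨y, z, rfl⟩ := List.length_eq_two.1 hlr
  have hc1 : offCount c [x, y, z] ≤ 1 := by rwa [← hxr, offCount_rotate]
  rw [hxr]
  simp only [List.take_succ_cons, List.take_zero, List.drop_succ_cons, List.drop_zero,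
    List.cons_append, List.nil_append]
  have hzero : ∀ y : F, corMod 1 [y, y] = 0 := fun y => by
    rw [corMod_pair le_rfl, sub_self, logMod_zero le_rfl]
  by_cases hxc : x = c
  · subst hxc
    rw [offCount_cons_self] at hc1
    by_cases hy : y = x
    · rw [hy, hzero, wedge_zero_left]
    · rw [offCount_cons_of_ne hy] at hc1
      by_cases hz : z = x
      · rw [hz, hzero, wedge_zero_right]
      · rw [offCount_cons_of_ne hz] at hc1; omega
  · rw [offCount_cons_of_ne hxc] at hc1
    have := eq_replicate_of_offCount_eq_zero (by omega : offCount c [y, z] = 0)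
    simp [List.replicate_succ] at this
    rw [this.1, this.2, wedge_self]

open Classical in
lemma corMod_pair_affine {m : ℕ} (hm : 1 ≤ m) {c : F} (hc : c ≠ 0) (b x y : F) :
    corMod m [c * x + b, c * y + b] = corMod m [x, y] + if x = y then 0 else logMod m c := by
  rw [corMod_pair hm, corMod_pair hm, add_sub_add_right_eq_sub, ← mul_sub]
  split_ifs with h
  · simp [h]
  · rw [logMod_mul hm hc (sub_ne_zero.2 h), add_comm]

open Classical in
lemma corMod_affine {m : ℕ} {c b : F} (hc : c ≠ 0) {w : List F} (hw : 3 ≤ w.length)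
    (hm : w.length ≤ m + 1) : corMod m (w.map fun x => c * x + b) = corMod m w := by
  induction hn : w.length using Nat.strong_induction_on generalizing w m with
  | _ N ih =>
  obtain ⟨n, rfl⟩ : ∃ n, N = n + 3 := ⟨N - 3, by omega⟩
  rw [corMod_eq_iff]
  refine relLE_mono (by omega : n + 2 ≤ m) (mem_relLE_of_mem_relSpan (Submodule.subset_span
    (Or.inl (Or.inr ⟨w, c, b, hn, hc, rfl⟩))) ?_)
  rw [map_sub, symCobracketMod_cor, symCobracketMod_cor]
  change cyclicCut (corMod (n + 1)) _ - cyclicCut (corMod (n + 1)) _ = 0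
  set φ : F → F := fun x => c * x + b
  set f : List F → Sym F ⧸ relLE (n + 1) F := corMod (n + 1)
  set ℓ := logMod (n + 1) c
  -- the change of the two logarithms next to the letter where a cut starts
  set α : List F → Sym F ⧸ relLE (n + 1) F := fun v => f ((v.take 2).map φ) - f (v.take 2) with hα
  set β : List F → Sym F ⧸ relLE (n + 1) F := fun v =>
    f ((v.take 1 ++ v.drop (n + 2)).map φ) - f (v.take 1 ++ v.drop (n + 2)) with hβ
  have hα' : ∀ x y r, α (x :: y :: r) = if x = y then 0 else ℓ := fun x y r => by
    simp [hα, φ, f, corMod_pair_affine (by omega : 1 ≤ n + 1) hc, ℓ]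
  have hβ' : ∀ x z r, r.length = n + 1 → β (x :: (r ++ [z])) = if x = z then 0 else ℓ :=
    fun x z r hr => by
      have : (x :: (r ++ [z])).drop (n + 2) = [z] := by
        rw [List.drop_succ_cons, ← hr, List.drop_left]
      simp only [hβ, this]
      simp [φ, f, corMod_pair_affine (by omega : 1 ≤ n + 1) hc, ℓ]
  have hcut : ∀ v : List F, v.length = n + 3 → cutSum f (v.map φ) - cutSum f v =
      wedge (α v) (f (v.take 1 ++ v.drop 2)) + wedge (f (v.take (n + 2))) (β v) := by
    intro v hv
    have hαβ : wedge (α v) (β v) = 0 := by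
      obtain ⟨x, y, r, z, rfl, hr⟩ : ∃ x y r z, v = x :: y :: (r ++ [z]) ∧ r.length = n := by
        match v, hv with
        | x :: y :: s, hv =>
          have hs : s ≠ [] := by rintro rfl; simp at hv
          exact ⟨x, y, s.dropLast, s.getLast hs, by rw [List.dropLast_append_getLast],
            by simp at hv ⊢; omega⟩
      rw [hα', ← List.cons_append, hβ' _ _ _ (by simp [hr])]
      split_ifs <;> simp
    have hterm : ∀ j ∈ Finset.Ico 1 (n + 2),
        wedge (f ((v.map φ).take (j + 1))) (f ((v.map φ).take 1 ++ (v.map φ).drop (j + 1))) -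
          wedge (f (v.take (j + 1))) (f (v.take 1 ++ v.drop (j + 1))) =
        (if j = 1 then wedge (α v) (f (v.take 1 ++ v.drop 2)) else 0) +
          if j = n + 1 then wedge (f (v.take (n + 2))) (β v) else 0 := by
      intro j hj
      rw [Finset.mem_Ico] at hj
      have hA : f ((v.map φ).take (j + 1)) = f (v.take (j + 1)) + if j = 1 then α v else 0 := by
        split_ifs with h
        · subst h; simp only [hα, List.map_take]; abel
        · have hl : (v.take (j + 1)).length = j + 1 := by simp; omega
          rw [← List.map_take, add_zero]
          exact ih (j + 1) (by omega) (by omega) (by omega) hl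
      have hB : f ((v.map φ).take 1 ++ (v.map φ).drop (j + 1)) =
          f (v.take 1 ++ v.drop (j + 1)) + if j = n + 1 then β v else 0 := by
        rw [← List.map_take, ← List.map_drop, ← List.map_append]
        split_ifs with h
        · subst h; simp only [hβ]; abel
        · have hl : (v.take 1 ++ v.drop (j + 1)).length = n + 3 - j := by simp; omega
          rw [add_zero]
          exact ih (n + 3 - j) (by omega) (by omega) (by omega) hl
      rw [hA, hB, wedge_add_left, wedge_add_right, wedge_add_right]
      by_cases h1 : j = 1
      · have e1 : v.drop 2 = v.drop (j + 1) := by rw [h1]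
        rw [if_pos h1, if_pos h1, e1]
        by_cases h2 : j = n + 1
        · have e2 : v.take (n + 2) = v.take (j + 1) := by rw [h2]
          rw [if_pos h2, if_pos h2, hαβ, e2]; abel
        · simp [h2]
      · rw [if_neg h1, if_neg h1]
        by_cases h2 : j = n + 1
        · have e2 : v.take (n + 2) = v.take (j + 1) := by rw [h2]
          rw [if_pos h2, if_pos h2, e2]; simp
        · simp [h2]
    unfold cutSum
    rw [List.length_map, ← Finset.sum_sub_distrib, show v.length - 1 = n + 2 by omega,
      Finset.sum_congr rfl hterm, Finset.sum_add_distrib, Finset.sum_ite_eq', Finset.sum_ite_eq',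
      if_pos (by simp), if_pos (by simp)]
  unfold cyclicCut
  rw [List.length_map, ← Finset.sum_sub_distrib]
  simp only [← List.map_rotate]
  rw [Finset.sum_congr rfl fun i _ => hcut (w.rotate i) (by simpa using hn),
    Finset.sum_add_distrib, ← sum_rotate_succ (fun v => wedge (f (v.take (n + 2))) (β v)),
    ← Finset.sum_add_distrib]
  have hrot : ∀ v : List F, v.length = n + 3 →
      wedge (α v) (f (v.take 1 ++ v.drop 2)) +
        wedge (f ((v.rotate 1).take (n + 2))) (β (v.rotate 1)) =
      wedge ℓ (f ((v.rotate 1).tail)) - wedge ℓ (f v.tail) := by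
    intro v hv
    match v, hv with
    | x :: y :: r, hv =>
      have hr : r.length = n + 1 := by simpa using hv
      have h1 : (x :: y :: r).rotate 1 = y :: (r ++ [x]) := by simp
      have h2 : (y :: (r ++ [x])).take (n + 2) = y :: r := by
        rw [List.take_succ_cons, ← hr, List.take_left]
      have h3 : f (x :: r) = f (r ++ [x]) :=
        corMod_append_comm (by omega) [x] r (by simp [hr]; omega)
      rw [h1, h2, hβ' _ _ _ hr, hα']
      simp only [List.take_succ_cons, List.take_zero, List.drop_succ_cons, List.drop_zero,
        List.cons_append, List.nil_append, List.tail_cons]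
      by_cases hxy : x = y
      · subst hxy; rw [h3]; simp
      · rw [if_neg hxy, if_neg (Ne.symm hxy), wedge_swap ℓ (f (y :: r)), h3]; abel
  simp only [← List.rotate_rotate]
  rw [Finset.sum_congr rfl fun i _ => hrot (w.rotate i) (by simpa using hn),
    Finset.sum_sub_distrib, sub_eq_zero]
  simp only [List.rotate_rotate]
  exact sum_rotate_succ (fun v => wedge ℓ (f v.tail)) w

end Invariance

/-! ### Relations in depth one -/

section DepthOne
variable {F : Type u} [Field F]
open Polynomial

/-- The word `0^p, 1, 0^q, a`. -/
def depthOneWord {R : Type u} [Zero R] [One R] (p q : ℕ) (a : R) : List R :=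
  List.replicate p 0 ++ 1 :: (List.replicate q 0 ++ [a])

@[simp] lemma length_depthOneWord {R : Type u} [Zero R] [One R] (p q : ℕ) (a : R) :
    (depthOneWord p q a).length = p + q + 2 := by
  simp [depthOneWord]; omega

lemma evalWord_depthOneWord (c : F) (p q : ℕ) (x : F[X]) :
    evalWord c (depthOneWord p q x) = depthOneWord p q (x.eval c) := by
  simp [evalWord, depthOneWord]

lemma ratWord_depthOneWord (p q : ℕ) (x : F[X]) :
    ratWord (depthOneWord p q x) = depthOneWord p q (algebraMap F[X] (RatFunc F) x) := by
  simp [ratWord, depthOneWord]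

lemma offCount_depthOneWord_le (p q : ℕ) (a : F) : offCount 0 (depthOneWord p q a) ≤ 2 := by
  have h1 := offCount_cons_le (0 : F) 1 (List.replicate q 0 ++ [a])
  have h2 := offCount_le_length (0 : F) [a]
  simp only [depthOneWord, offCount_append, offCount_replicate_self, List.length_singleton,
    zero_add] at h1 h2 ⊢
  omega

lemma offCount_replicate_append_cons_le (p q : ℕ) (a : F) :
    offCount 0 (List.replicate p 0 ++ a :: List.replicate q 0) ≤ 1 := by
  have := offCount_cons_le (0 : F) a (List.replicate q 0)
  simpa using this

lemma isDegenerate_depthOneWord_zero (p q : ℕ) :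
    IsDegenerate (depthOneWord p q (0 : F)) := by
  refine isDegenerate_of_offCount (c := 0) (by simp [depthOneWord]) ?_
  have h1 := offCount_cons_le (0 : F) 1 (List.replicate q 0 ++ [0])
  simp only [depthOneWord, offCount_append, offCount_replicate_self, offCount_cons_self,
    offCount_nil] at h1 ⊢
  omega

lemma depthOneWord_ne {p q : ℕ} (h : 1 ≤ p + q) (a : F) :
    ∃ y ∈ depthOneWord p q a, ∃ z ∈ depthOneWord p q a, y ≠ z := by
  refine ⟨0, ?_, 1, by simp [depthOneWord], zero_ne_one⟩
  simp only [depthOneWord, List.mem_append, List.mem_replicate, List.mem_cons]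
  obtain hp | hq : p ≠ 0 ∨ q ≠ 0 := by omega
  · exact Or.inl ⟨hp, trivial⟩
  · exact Or.inr (Or.inr (Or.inl ⟨hq, trivial⟩))

/-- Only the cuts with a part of weight one contribute to the cobracket of a word of depth
one. -/
lemma cyclicCut_of_offCount_le_two {m : ℕ} {c : F} {w : List F} (hw : 4 ≤ w.length)
    (hm : w.length ≤ m + 2) (h : offCount c w ≤ 2) :
    cyclicCut (corMod m) w = ∑ i ∈ Finset.range w.length,
      wedge (corMod m ((w.rotate i).take 2))
        (corMod m ((w.rotate i).take 1 ++ (w.rotate i).drop 2) -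
          corMod m ((w.rotate i).drop 1)) := by
  obtain ⟨n, hn⟩ : ∃ n, w.length = n + 4 := ⟨w.length - 4, by omega⟩
  set f := corMod (F := F) m
  have hcut : ∀ v : List F, v.length = n + 4 → offCount c v ≤ 2 → cutSum f v =
      wedge (f (v.take 2)) (f (v.take 1 ++ v.drop 2)) +
        wedge (f (v.take (n + 3))) (f (v.take 1 ++ v.drop (n + 3))) := by
    intro v hv hc
    unfold cutSum
    rw [show v.length - 1 = n + 2 + 1 by omega, Finset.sum_Ico_succ_top (by omega),
      Finset.sum_eq_sum_Ico_succ_bot (by omega), Finset.sum_eq_zero, add_zero]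
    intro j hj
    rw [Finset.mem_Ico] at hj
    obtain ⟨x, r, rfl⟩ : ∃ x r, v = x :: r := by
      cases v with
      | nil => simp at hv
      | cons x r => exact ⟨x, r, rfl⟩
    have h1 := offCount_cut c x r j
    have h2 := offCount_le_length c [x]
    simp only [List.length_singleton] at h2
    have hA : ((x :: r).take (j + 1)).length = j + 1 := by simp at hv ⊢; omega
    have hB : ((x :: r).take 1 ++ (x :: r).drop (j + 1)).length = n + 4 - j := by
      simp at hv ⊢; omega
    by_cases hA1 : offCount c ((x :: r).take (j + 1)) ≤ 1
    · rw [show f ((x :: r).take (j + 1)) = 0 from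
        corMod_eq_zero_of_offCount (by omega) (by omega) hA1, wedge_zero_left]
    · rw [show f ((x :: r).take 1 ++ (x :: r).drop (j + 1)) = 0 from
        corMod_eq_zero_of_offCount (c := c) (by omega) (by omega) (by omega), wedge_zero_right]
  unfold cyclicCut
  rw [Finset.sum_congr rfl fun i _ => hcut (w.rotate i) (by simpa using hn) (by simpa using h),
    Finset.sum_add_distrib,
    ← sum_rotate_succ (fun v => wedge (f (v.take (n + 3))) (f (v.take 1 ++ v.drop (n + 3)))),
    ← Finset.sum_add_distrib]
  refine Finset.sum_congr rfl fun i _ => ?_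
  rw [← List.rotate_rotate]
  obtain ⟨x, y, r, hv⟩ : ∃ x y r, w.rotate i = x :: y :: r := by
    have hl : (w.rotate i).length = n + 4 := by simpa using hn
    match h : w.rotate i with
    | [] => simp [h] at hl
    | [_] => simp [h] at hl
    | x :: y :: r => exact ⟨x, y, r, rfl⟩
  have hr : r.length = n + 2 := by
    have := congrArg List.length hv
    simp at this; omega
  have h2 : (y :: (r ++ [x])).take (n + 3) = y :: r := by
    rw [List.take_succ_cons, ← hr, List.take_left]
  have h3 : (y :: (r ++ [x])).drop (n + 3) = [x] := by
    rw [List.drop_succ_cons, ← hr, List.drop_left]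
  have h4 : (x :: y :: r).rotate 1 = y :: (r ++ [x]) := by simp
  have h5 : f [y, x] = f [x, y] := corMod_append_comm (by omega) [y] [x] (by simp; omega)
  rw [hv, h4, h2, h3]
  simp only [List.take_succ_cons, List.take_zero, List.drop_succ_cons, List.drop_zero,
    List.cons_append, List.nil_append]
  rw [h5, wedge_sub_right, wedge_swap (f [x, y]) (f (y :: r)), sub_eq_add_neg]

/-- The cobracket of `Cor(0^p, 1, 0^q, a)` is
`log a ∧ (Cor(0^{p-1}, 1, 0^q, a) - Cor(0^p, 1, 0^{q-1}, a))`. -/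
lemma cyclicCut_depthOneWord {m p q : ℕ} (hpq : 1 ≤ p + q) (hm : p + q ≤ m) (a : F) :
    cyclicCut (corMod m) (depthOneWord p q a) =
      wedge (logMod m a) ((if p = 0 then 0 else corMod m (depthOneWord (p - 1) q a)) -
        if q = 0 then 0 else corMod m (depthOneWord p (q - 1) a)) := by
  have hm1 : 1 ≤ m := by omega
  obtain h1 | h2 : p + q = 1 ∨ 2 ≤ p + q := by omega
  · have h3 : ∀ x y z : F, cyclicCut (corMod m) [x, y, z] =
        wedge (corMod m [x, y]) (corMod m [x, z]) + wedge (corMod m [y, z]) (corMod m [y, x]) +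
          wedge (corMod m [z, x]) (corMod m [z, y]) := fun x y z => by
      simp [cyclicCut, cutSum, Finset.sum_range_succ]
    have h10 : corMod m [(1 : F), 0] = 0 := logMod_one hm1
    have h01 : corMod m [(0 : F), 1] = 0 := by
      rw [corMod_pair hm1, zero_sub, logMod_neg hm1, logMod_one hm1]
    have ha : corMod m [1, a] = corMod m [a, 1] :=
      corMod_append_comm hm1 [1] [a] (by simp; omega)
    obtain ⟨rfl, rfl⟩ | ⟨rfl, rfl⟩ : p = 1 ∧ q = 0 ∨ p = 0 ∧ q = 1 := by omega
    · simp [depthOneWord, h3, h10, h01, logMod, ha]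
    · simp [depthOneWord, h3, h10, h01, logMod, ha]
      rw [wedge_swap]
  · set u : List F := List.replicate p 0 ++ 1 :: List.replicate q 0 with hu
    have hw : depthOneWord p q a = u ++ [a] := by simp [depthOneWord, hu]
    have hul : u.length = p + q + 1 := by simp [hu]; omega
    have hu01 : ∀ x ∈ u, x = 0 ∨ x = 1 := by
      intro x hx
      simp only [hu, List.mem_append, List.mem_replicate, List.mem_cons] at hx
      tauto
    have hdeg : ∀ (s t : ℕ), s + t + 1 = p + q →
        corMod m ((0 : F) :: (List.replicate s 0 ++ 1 :: List.replicate t 0)) = 0 := by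
      intro s t hst
      refine corMod_eq_zero_of_offCount (c := 0) (by simp; omega) (by simp; omega) ?_
      rw [offCount_cons_self]
      exact offCount_replicate_append_cons_le s t 1
    have hcons : ∀ (x : F) (t : ℕ), t = p + q → corMod m (x :: List.replicate t 0) = 0 := by
      intro x t ht
      refine corMod_eq_zero_of_offCount (c := 0) (by simp; omega) (by simp; omega) ?_
      exact (offCount_cons_le _ _ _).trans (by simp)
    rw [cyclicCut_of_offCount_le_two (c := 0) (by simp; omega) (by simp; omega)
      (offCount_depthOneWord_le p q a), length_depthOneWord, hw,
      Finset.sum_range_succ, Finset.sum_range_succ, Finset.sum_eq_zero, zero_add]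
    · -- the two letters next to `a`
      have hfirst : (u ++ [a]).rotate (p + q + 1) = a :: u := by
        rw [← hul, List.rotate_append_length_eq]; rfl
      rw [hfirst, wedge_sub_right (logMod m a), add_comm]
      refine (congrArg₂ (· + ·) ?_ ?_).trans (sub_eq_add_neg _ _).symm
      · rcases p with _ | p
        · have e := hcons a q (by omega)
          have e' := hcons 1 q (by omega)
          simp [hu, e, e']
        · have e : corMod m (a :: (List.replicate p 0 ++ 1 :: List.replicate q 0)) =
              corMod m (depthOneWord p q a) := by
            have := corMod_append_comm (m := m) (by omega) [a]
              (List.replicate p 0 ++ 1 :: List.replicate q 0) (by simp; omega)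
            simpa [depthOneWord] using this
          have e' := hdeg p q (by omega)
          simp [hu, List.replicate_succ, e, e', logMod]
      · rcases q with _ | q
        · have e : (u ++ [a]).rotate (p + 0) = 1 :: a :: List.replicate p 0 := by
            have := List.rotate_append_length_eq (List.replicate p (0 : F)) [1, a]
            simpa [hu] using this
          have e1 := hcons 1 p (by omega)
          have e2 := hcons a p (by omega)
          rw [e]
          simp [e1, e2]
        · have e : (u ++ [a]).rotate (p + (q + 1)) =
              0 :: a :: (List.replicate p 0 ++ 1 :: List.replicate q 0) := by
            have := List.rotate_append_length_eq
              (List.replicate p (0 : F) ++ 1 :: List.replicate q 0) [0, a]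
            have hl : (List.replicate p (0 : F) ++ 1 :: List.replicate q 0).length =
              p + (q + 1) := by simp
            rw [hl] at this
            simpa [hu, List.replicate_succ'] using this
          have e1 := hdeg p q (by omega)
          have e2 : corMod m (a :: (List.replicate p 0 ++ 1 :: List.replicate q 0)) =
              corMod m (depthOneWord p q a) := by
            have := corMod_append_comm (m := m) (by omega) [a]
              (List.replicate p 0 ++ 1 :: List.replicate q 0) (by simp; omega)
            simpa [depthOneWord] using this
          have e3 : corMod m [0, a] = logMod m a := by
                rw [corMod_pair hm1, zero_sub, logMod_neg hm1]
          rw [e]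
          simp [e1, e2, e3]
    · -- all other pairs of neighbours are pairs of letters `0`, `1`
      intro i hi
      rw [Finset.mem_range] at hi
      obtain ⟨x, y, r, hxy⟩ : ∃ x y r, u.drop i = x :: y :: r := by
        have hl : (u.drop i).length = p + q + 1 - i := by rw [List.length_drop, hul]
        match h : u.drop i with
        | [] => simp [h] at hl; omega
        | [_] => simp [h] at hl; omega
        | x :: y :: r => exact ⟨x, y, r, rfl⟩
      have hrot : (u ++ [a]).rotate i = x :: y :: (r ++ [a] ++ u.take i) := by
        rw [List.rotate_eq_drop_append_take (by simp; omega), List.drop_append_of_le_length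
          (by omega), List.take_append_of_le_length (by omega), hxy]
        simp
      have hx : x ∈ u := List.mem_of_mem_drop (i := i) (by simp [hxy])
      have hy : y ∈ u := List.mem_of_mem_drop (i := i) (by simp [hxy])
      have hzero : corMod m [x, y] = 0 := by
        rw [corMod_pair hm1]
        rcases hu01 x hx with rfl | rfl <;> rcases hu01 y hy with rfl | rfl
        · rw [sub_zero, logMod_zero hm1]
        · rw [zero_sub, logMod_neg hm1, logMod_one hm1]
        · rw [sub_zero, logMod_one hm1]
        · rw [sub_self, logMod_zero hm1]
      rw [hrot]
      simp [hzero]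

lemma symCobracketMod_depthOneWord {m p q : ℕ} (hpq : 1 ≤ p + q) (hm : p + q ≤ m) (a : F) :
    symCobracketMod (relLE m F) (cor (depthOneWord p q a)) =
      wedge (logMod m a) ((if p = 0 then 0 else corMod m (depthOneWord (p - 1) q a)) -
        if q = 0 then 0 else corMod m (depthOneWord p (q - 1) a)) := by
  rw [symCobracketMod_cor]
  exact cyclicCut_depthOneWord hpq hm a

/-- The zeros of a word of depth one can be moved to the front. -/
lemma corMod_depthOneWord (N : ℕ) : ∀ {F : Type u} [Field F] {m p q : ℕ}, p + q = N →
    N + 1 ≤ m → ∀ a : F, corMod m (depthOneWord p q a) =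
      ((-1 : ℚ) ^ q * N.choose q) • corMod m (depthOneWord N 0 a) := by
  induction N with
  | zero =>
    intro F _ m p q hpq hm a
    obtain ⟨rfl, rfl⟩ : p = 0 ∧ q = 0 := by omega
    simp
  | succ N ih =>
    intro F _ m p q hpq hm a
    have hker : ∀ {K : Type u} [Field K] (a : K), symCobracketMod (relLE (N + 1) K)
        (cor (depthOneWord p q a) + (-((-1 : ℚ) ^ q * (N + 1).choose q)) •
          cor (depthOneWord (N + 1) 0 a)) = 0 := by
      intro K _ a
      rw [map_add, map_smul, symCobracketMod_depthOneWord (by omega) (by omega),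
        symCobracketMod_depthOneWord (by omega) (by omega)]
      have e1 : (if p = 0 then 0 else corMod (N + 1) (depthOneWord (p - 1) q a)) =
          ((-1 : ℚ) ^ q * N.choose q) • corMod (N + 1) (depthOneWord N 0 a) := by
        split_ifs with h
        · rw [Nat.choose_eq_zero_of_lt (by omega)]; simp
        · exact ih (by omega) le_rfl a
      rw [e1]
      rcases q with _ | q
      · simp [tensor_neg_smul]
      · simp only [Nat.add_sub_cancel, Nat.add_one_ne_zero, if_false, if_true, sub_zero]
        rw [ih (by omega : p + q = N) le_rfl a, ← sub_smul, wedge_smul_right, ← add_smul]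
        rw [Nat.choose_succ_succ]
        push_cast
        rw [show ((-1 : ℚ) ^ (q + 1) * N.choose (q + 1) - (-1) ^ q * N.choose q +
          -((-1) ^ (q + 1) * (N.choose q + N.choose (q + 1)))) = 0 by ring, zero_smul]
    have key := mem_relLE_of_deformation (n := N) a 0 (ι := Fin 2)
      ![1, -((-1 : ℚ) ^ q * (N + 1).choose q)]
      ![depthOneWord p q X, depthOneWord (N + 1) 0 X] ?_ ?_ ?_ ?_ ?_ ?_
    · have key' := relLE_mono (by omega : N + 2 ≤ m) key
      simp only [Fin.sum_univ_two, Matrix.cons_val_zero, Matrix.cons_val_one, one_smul,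
        evalWord_depthOneWord, eval_X] at key'
      have := (Submodule.Quotient.mk_eq_zero _).2 key'
      rw [Submodule.Quotient.mk_add, Submodule.Quotient.mk_smul, neg_smul,
        ← sub_eq_add_neg, sub_eq_zero] at this
      exact this
    · simp [Fin.forall_fin_two]; omega
    · simp only [Fin.forall_fin_two, Matrix.cons_val_zero, Matrix.cons_val_one,
        evalWord_depthOneWord]
      exact ⟨depthOneWord_ne (by omega) _, depthOneWord_ne (by omega) _⟩
    · simp only [Fin.forall_fin_two, Matrix.cons_val_zero, Matrix.cons_val_one,
        evalWord_depthOneWord]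
      exact ⟨depthOneWord_ne (by omega) _, depthOneWord_ne (by omega) _⟩
    · simp only [Fin.forall_fin_two, Matrix.cons_val_zero, Matrix.cons_val_one,
        evalWord_depthOneWord, eval_X]
      exact ⟨isDegenerate_depthOneWord_zero _ _, isDegenerate_depthOneWord_zero _ _⟩
    · simp only [Fin.sum_univ_two, Matrix.cons_val_zero, Matrix.cons_val_one, one_smul,
        ratWord_depthOneWord]
      exact hker _
    · simp only [Fin.sum_univ_two, Matrix.cons_val_zero, Matrix.cons_val_one, one_smul,
        evalWord_depthOneWord]
      exact hker _

/-- The distribution relation `Li_{N+1}(a²) = 2^N (Li_{N+1}(a) + Li_{N+1}(-a))`. For `N = 0` it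
says `log (1 - a²) = log (1 - a) + log (1 + a)`, which fails when `a² = 1`. -/
lemma corMod_distribution (N : ℕ) : ∀ {F : Type u} [Field F] {m : ℕ}, N + 1 ≤ m → ∀ a : F,
    (N = 0 → a ^ 2 ≠ 1) → corMod m (depthOneWord N 0 (a ^ 2)) =
      (2 : ℚ) ^ N • (corMod m (depthOneWord N 0 a) + corMod m (depthOneWord N 0 (-a))) := by
  induction N with
  | zero =>
    intro F _ m hm a ha
    have h1 : (1 : F) - a ≠ 0 := fun h => ha rfl (by rw [← sub_eq_zero.1 h, one_pow])
    have h2 : (1 : F) - -a ≠ 0 := fun h => ha rfl (by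
      rw [← neg_sq, ← sub_eq_zero.1 h, one_pow])
    simp only [depthOneWord, List.replicate_zero, List.nil_append, pow_zero, one_smul]
    rw [corMod_pair hm, corMod_pair hm, corMod_pair hm, ← logMod_mul hm h1 h2]
    congr 1; ring
  | succ N ih =>
    intro F _ m hm a _
    have hker : ∀ {K : Type u} [Field K] (a : K), symCobracketMod (relLE (N + 1) K)
        (cor (depthOneWord (N + 1) 0 (a ^ 2)) +
          (-((2 : ℚ) ^ (N + 1))) • cor (depthOneWord (N + 1) 0 a) +
          (-((2 : ℚ) ^ (N + 1))) • cor (depthOneWord (N + 1) 0 (-a))) = 0 := by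
      intro K _ a
      have h1 : 1 ≤ N + 1 := by omega
      rw [map_add, map_add, map_smul, map_smul,
        symCobracketMod_depthOneWord (p := N + 1) (q := 0) h1 le_rfl,
        symCobracketMod_depthOneWord (p := N + 1) (q := 0) h1 le_rfl,
        symCobracketMod_depthOneWord (p := N + 1) (q := 0) h1 le_rfl,
        logMod_neg h1]
      simp only [Nat.add_one_ne_zero, if_false, if_true, sub_zero, Nat.add_sub_cancel]
      by_cases h0 : a = 0
      · subst h0; simp [logMod_zero h1]
      have hlog : logMod (N + 1) (a ^ 2) = (2 : ℚ) • logMod (N + 1) a := by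
        rw [sq, logMod_mul h1 h0 h0, two_smul]
      by_cases ha : a ^ 2 = 1
      · rw [ha, logMod_one h1, eq_comm, smul_eq_zero] at hlog
        rw [ha, logMod_one h1, hlog.resolve_left two_ne_zero]
        simp
      · rw [hlog, ih le_rfl a fun _ => ha, wedge_smul_left, wedge_smul_right, wedge_add_right,
          smul_smul, ← pow_succ', smul_add, tensor_neg_smul, tensor_neg_smul]
        abel
    have key := mem_relLE_of_deformation (n := N) a 0 (ι := Fin 3)
      ![1, -((2 : ℚ) ^ (N + 1)), -((2 : ℚ) ^ (N + 1))]
      ![depthOneWord (N + 1) 0 (X ^ 2), depthOneWord (N + 1) 0 X,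
        depthOneWord (N + 1) 0 (-X)] ?_ ?_ ?_ ?_ ?_ ?_
    · have key' := relLE_mono (by omega : N + 2 ≤ m) key
      simp only [Fin.sum_univ_three, Matrix.cons_val, one_smul,
        evalWord_depthOneWord, eval_X, eval_pow, eval_neg] at key'
      have := (Submodule.Quotient.mk_eq_zero _).2 key'
      rw [Submodule.Quotient.mk_add, Submodule.Quotient.mk_add, Submodule.Quotient.mk_smul,
        Submodule.Quotient.mk_smul, add_assoc, ← smul_add, neg_smul,
        ← sub_eq_add_neg, sub_eq_zero] at this
      exact this
    · intro i; fin_cases i <;> simp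
    · intro i; fin_cases i <;> simp only [evalWord_depthOneWord, Matrix.cons_val, Fin.zero_eta,
        Fin.mk_one, Fin.reduceFinMk] <;> exact depthOneWord_ne (by omega) _
    · intro i; fin_cases i <;> simp only [evalWord_depthOneWord, Matrix.cons_val, Fin.zero_eta,
        Fin.mk_one, Fin.reduceFinMk] <;> exact depthOneWord_ne (by omega) _
    · intro i; fin_cases i <;> simp [evalWord_depthOneWord, isDegenerate_depthOneWord_zero]
    · simp only [Fin.sum_univ_three, Matrix.cons_val, one_smul,
        ratWord_depthOneWord, map_pow, map_neg]
      exact hker _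
    · simp only [Fin.sum_univ_three, Matrix.cons_val, one_smul,
        evalWord_depthOneWord, eval_X, eval_pow, eval_neg]
      exact hker _

end DepthOne

/-! ### Correlators of weight at least two in the Lie coalgebra -/

section Gam
variable {F : Type u} [Field F]

/-- The class in `𝓛(F)` of a correlator of weight at least two; it is `0` in smaller weight. -/
def gam (w : List F) : L F := (rel F).mkQ (symTrunc F (cor w))

lemma gam_of_le {w : List F} (h : 3 ≤ w.length) : gam w = (rel F).mkQ (cor w) := by
  rw [gam, symTrunc, linearCombination_cor, if_pos h]

lemma gam_of_lt {w : List F} (h : w.length < 3) : gam w = 0 := by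
  rw [gam, symTrunc, linearCombination_cor, if_neg (by omega), map_zero]

lemma truncCobracket_mkQ_cor (w : List F) :
    truncCobracket F ((rel F).mkQ (cor w)) = cyclicCut gam w := by
  rw [truncCobracket, LinearMap.comp_apply, cobracket, Submodule.mkQ_apply, Submodule.liftQ_apply,
    symCobracketMod, LinearMap.comp_apply, ← LinearMap.comp_apply, ← TensorProduct.map_comp,
    map_symCobracket_cor]
  rfl

lemma truncCobracket_gam {w : List F} (h : 3 ≤ w.length) :
    truncCobracket F (gam w) = cyclicCut gam w := by
  rw [gam_of_le h, truncCobracket_mkQ_cor]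

/-- Relations modulo `relLE m` give relations in `𝓛(F)`. -/
lemma gam_eq_mapQ {w : List F} {m : ℕ} (h : 3 ≤ w.length) :
    gam w = (relLE m F).mapQ (rel F) LinearMap.id (relLE_le_rel m) (corMod m w) := by
  rw [gam_of_le h]
  rfl

lemma gam_append_comm (v w : List F) : gam (v ++ w) = gam (w ++ v) := by
  by_cases h : 3 ≤ (v ++ w).length
  · have h' : 3 ≤ (w ++ v).length := by simp at h ⊢; omega
    rw [gam_eq_mapQ (m := (v ++ w).length) h, gam_eq_mapQ (m := (v ++ w).length) h',
      corMod_append_comm (by omega) v w (by simp)]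
  · rw [gam_of_lt (by omega), gam_of_lt (by simp at h ⊢; omega)]

lemma gam_affine {c : F} (hc : c ≠ 0) (b : F) (w : List F) :
    gam (w.map fun x => c * x + b) = gam w := by
  by_cases h : 3 ≤ w.length
  · rw [gam_eq_mapQ (w := w) (m := w.length) h, gam_eq_mapQ (m := w.length) (by simpa using h),
      corMod_affine hc h (by omega)]
  · rw [gam_of_lt (w := w) (by omega), gam_of_lt (by rw [List.length_map]; omega)]

lemma gam_scale {c : F} (hc : c ≠ 0) (w : List F) : gam (w.map fun x => c * x) = gam w := by
  simpa using gam_affine hc 0 w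

lemma gam_eq_zero {c : F} {w : List F} (h : offCount c w ≤ 1) : gam w = 0 := by
  by_cases h3 : 3 ≤ w.length
  · rw [gam_eq_mapQ (m := w.length) h3, corMod_eq_zero_of_offCount h3 (by omega) h, map_zero]
  · exact gam_of_lt (by omega)

/-- The classical polylogarithm of weight `p + 1`, up to sign. -/
def classicalGam (p : ℕ) (a : F) : L F := gam (depthOneWord p 0 a)

lemma gam_depthOneWord (p q : ℕ) (a : F) : gam (depthOneWord p q a) =
    ((-1 : ℚ) ^ q * (p + q).choose q) • classicalGam (p + q) a := by
  rw [classicalGam]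
  by_cases h : 1 ≤ p + q
  · rw [gam_eq_mapQ (m := p + q + 1) (by simp; omega),
      gam_eq_mapQ (m := p + q + 1) (by simp; omega), corMod_depthOneWord (p + q) rfl le_rfl,
      map_smul]
  · rw [gam_of_lt (by simp; omega), gam_of_lt (by simp; omega), smul_zero]

lemma classicalGam_zero (a : F) : classicalGam 0 a = 0 := gam_of_lt (by simp)

lemma classicalGam_sq (p : ℕ) (a : F) : classicalGam p (a ^ 2) =
    (2 : ℚ) ^ p • (classicalGam p a + classicalGam p (-a)) := by
  rcases p with _ | p
  · simp [classicalGam_zero]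
  · have h3 : ∀ a : F, 3 ≤ (depthOneWord (p + 1) 0 a).length := fun a => by simp
    simp only [classicalGam]
    rw [gam_eq_mapQ (m := p + 2) (h3 _), gam_eq_mapQ (m := p + 2) (h3 _),
      gam_eq_mapQ (m := p + 2) (h3 _), corMod_distribution (p + 1) le_rfl a (by simp), map_smul,
      map_add]

/-! ### The depth filtration -/

lemma iterInt_eq {w : List F} (h : 3 ≤ w.length) : iterInt w = gam w - gam (0 :: w.dropLast) := by
  rw [iterInt, map_sub, gam_of_le h, gam_of_le]
  simp; omega

lemma length_polylogWord (p : F) (l : List (ℕ+ × Fˣ)) :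
    (polylogWord p l).length = (l.map fun x => (x.1 : ℕ)).sum + 1 := by
  induction l generalizing p with
  | nil => rfl
  | cons x l ih =>
    obtain ⟨n, a⟩ := x
    have := n.pos
    simp only [polylogWord, List.length_cons, List.length_append, List.length_replicate, ih,
      List.map_cons, List.sum_cons]
    omega

lemma offCount_polylogWord_le (p : F) (l : List (ℕ+ × Fˣ)) :
    offCount 0 (polylogWord p l) ≤ l.length + 1 := by
  induction l generalizing p with
  | nil => exact offCount_le_length _ _
  | cons x l ih =>
    obtain ⟨n, a⟩ := x
    rw [polylogWord]
    refine (offCount_cons_le _ _ _).trans ?_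
    rw [offCount_append, offCount_replicate_self, zero_add, List.length_cons]
    exact Nat.succ_le_succ (ih _)

lemma polylog_eq {n₀ : ℕ} {l : List (ℕ+ × Fˣ)} (h : 2 ≤ polylogWeight n₀ l) :
    polylog n₀ l = (-1 : ℚ) ^ l.length • (gam (List.replicate n₀ 0 ++ polylogWord 1 l) -
      gam (0 :: (List.replicate n₀ 0 ++ polylogWord 1 l).dropLast)) := by
  rw [polylog, iterInt_eq]
  rw [polylogWeight] at h
  rw [List.length_append, List.length_replicate, length_polylogWord]
  omega

/-- Every word that starts and ends with nonzero letters comes from a multiple polylogarithm. -/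
lemma exists_polylogWord {y : F} (hy : y ≠ 0) (v : List F) : ∀ (k : ℕ) {p : F}, p ≠ 0 →
    ∃ l : List (ℕ+ × Fˣ), polylogWord p l = p :: (List.replicate k 0 ++ (v ++ [y])) ∧
      l.length = offCount 0 v + 1 := by
  induction v with
  | nil =>
    intro k p hp
    refine ⟨[(k.succPNat, Units.mk0 (y / p) (div_ne_zero hy hp))], ?_, by simp⟩
    simp [polylogWord, mul_div_cancel₀ y hp]
  | cons z v ih =>
    intro k p hp
    by_cases hz : z = 0
    · subst hz
      obtain ⟨l, h1, h2⟩ := ih (k + 1) hp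
      exact ⟨l, by rw [h1, List.replicate_succ']; simp, by rw [h2, offCount_cons_self]⟩
    · obtain ⟨l, h1, h2⟩ := ih 0 hz
      refine ⟨(k.succPNat, Units.mk0 (z / p) (div_ne_zero hz hp)) :: l, ?_, ?_⟩
      · simp [polylogWord, mul_div_cancel₀ z hp, h1]
      · rw [List.length_cons, h2, offCount_cons_of_ne hz]

lemma exists_first_ne_zero (u : List F) (h : offCount 0 u ≠ 0) :
    ∃ (k : ℕ) (z : F) (v : List F), z ≠ 0 ∧ u = List.replicate k 0 ++ z :: v := by
  induction u with
  | nil => simp at h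
  | cons x u ih =>
    by_cases hx : x = 0
    · subst hx
      rw [offCount_cons_self] at h
      obtain ⟨k, z, v, hz, rfl⟩ := ih h
      exact ⟨k + 1, z, v, hz, by simp [List.replicate_succ]⟩
    · exact ⟨0, x, u, hx, rfl⟩

lemma depthFiltration_mono {m n : ℕ} (h : m ≤ n) : depthFiltration F m ≤ depthFiltration F n :=
  Submodule.span_mono fun _ ⟨n₀, l, h1, h2, h3, h4⟩ => ⟨n₀, l, h1, h2.trans h, h3, h4⟩

lemma eq_zero_of_mem_depthFiltration_zero {x : L F} (h : x ∈ depthFiltration F 0) : x = 0 := by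
  have : {x : L F | ∃ (n₀ : ℕ) (l : List (ℕ+ × Fˣ)), 1 ≤ l.length ∧ l.length ≤ 0 ∧
      2 ≤ polylogWeight n₀ l ∧ x = polylog n₀ l} = ∅ := by
    ext; simp only [Set.mem_ofPred_eq, Set.mem_empty_iff_false, iff_false]
    rintro ⟨n₀, l, h1, h2, -⟩; omega
  rw [depthFiltration, this, Submodule.span_empty] at h
  exact h

lemma gam_sub_mem {u : List F} {y : F} (hy : y ≠ 0) {m : ℕ} (h : offCount 0 u ≤ m) :
    gam (u ++ [y]) - gam (0 :: u) ∈ depthFiltration F m := by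
  by_cases h3 : 3 ≤ (u ++ [y]).length
  swap
  · rw [gam_of_lt (by omega), gam_of_lt (by simp at h3 ⊢; omega), sub_zero]
    exact Submodule.zero_mem _
  by_cases h0 : offCount 0 u = 0
  · have := offCount_le_length (0 : F) [y]
    rw [gam_eq_zero (c := 0) (by rw [offCount_append]; simp at this; omega),
      gam_eq_zero (c := 0) (by rw [offCount_cons_self]; omega), sub_zero]
    exact Submodule.zero_mem _
  obtain ⟨k, z, v, hz, rfl⟩ := exists_first_ne_zero u h0
  have hs : z⁻¹ ≠ 0 := inv_ne_zero hz
  have hinj : Function.Injective fun x : F => z⁻¹ * x := mul_right_injective₀ hs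
  obtain ⟨l, h1, h2⟩ := exists_polylogWord (mul_ne_zero hs hy) (v.map fun x => z⁻¹ * x) 0
    (one_ne_zero (α := F))
  have hv : offCount 0 (v.map fun x => z⁻¹ * x) = offCount 0 v := by
    have := offCount_map hinj 0 v
    rwa [mul_zero] at this
  rw [offCount_append, offCount_replicate_self, offCount_cons_of_ne hz] at h
  have hword : (List.replicate k 0 ++ z :: v ++ [y]).map (fun x => z⁻¹ * x) =
      List.replicate k 0 ++ polylogWord 1 l := by
    rw [h1]; simp [inv_mul_cancel₀ hz]
  have hword' : ((0 : F) :: (List.replicate k 0 ++ z :: v)).map (fun x => z⁻¹ * x) =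
      0 :: (List.replicate k 0 ++ polylogWord 1 l).dropLast := by
    rw [← hword, ← List.map_dropLast, List.dropLast_concat]; simp
  have hw : 2 ≤ polylogWeight k l := by
    have := congrArg List.length hword
    rw [List.length_append (as := List.replicate k 0), length_polylogWord, List.length_map,
      List.length_replicate] at this
    rw [polylogWeight]; omega
  have hp := polylog_eq hw
  rw [← gam_scale hs, ← gam_scale hs (0 :: _), hword, hword']
  have : gam (List.replicate k 0 ++ polylogWord 1 l) -
      gam (0 :: (List.replicate k 0 ++ polylogWord 1 l).dropLast) =
        (-1 : ℚ) ^ l.length • polylog k l := by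
    rw [hp, smul_smul, ← mul_pow, neg_one_mul, neg_neg, one_pow, one_smul]
  rw [this]
  exact Submodule.smul_mem _ _ (Submodule.subset_span ⟨k, l, by omega, by omega, hw, rfl⟩)

/-- Removing the last letter and adding a zero in front expresses every correlator that contains
the letter `0` through iterated integrals. -/
lemma gam_replicate_append_mem {m : ℕ} (v : List F) : ∀ (k : ℕ), offCount 0 v ≤ m + 1 →
    gam (List.replicate (k + 1) 0 ++ v) ∈ depthFiltration F m := by
  induction v using List.reverseRecOn with
  | nil =>
    intro k _
    rw [gam_eq_zero (c := 0) (by simp)]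
    exact Submodule.zero_mem _
  | append_singleton v y ih =>
    intro k h
    rw [offCount_append] at h
    have h' := ih (k + 1) (by omega)
    rw [List.replicate_succ, List.cons_append] at h'
    rw [← List.append_assoc]
    by_cases hy : y = 0
    · subst hy
      rw [gam_append_comm]
      exact h'
    · have : offCount 0 [y] = 1 := by rw [offCount_cons_of_ne hy, offCount_nil]
      rw [← sub_add_cancel (gam _) (gam (0 :: (List.replicate (k + 1) 0 ++ v)))]
      refine Submodule.add_mem _ (gam_sub_mem hy ?_) h'
      rw [offCount_append, offCount_replicate_self]
      omega

lemma gam_mem_of_mem {m : ℕ} {c : F} {w : List F} (hc : c ∈ w) (h : offCount c w ≤ m + 1) :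
    gam w ∈ depthFiltration F m := by
  obtain ⟨s, t, rfl⟩ := List.append_of_mem hc
  have hinj : Function.Injective fun x : F => 1 * x + -c := fun x y h => by simpa using h
  rw [gam_append_comm, ← gam_affine one_ne_zero (-c)]
  have h2 := offCount_map hinj c (t ++ s)
  rw [one_mul, add_neg_cancel] at h2
  have := gam_replicate_append_mem (m := m) ((t ++ s).map fun x => 1 * x + -c) 0 (by
    rw [h2]
    rw [offCount_append, offCount_cons_self] at h
    rw [offCount_append]; omega)
  simpa using this

/-- A correlator with `m + 1` letters different from a fixed `c` has depth at most `m`. -/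
lemma gam_mem (c : F) (w : List F) : gam w ∈ depthFiltration F (offCount c w - 1) := by
  by_cases hc : c ∈ w
  · exact gam_mem_of_mem hc (by omega)
  · cases w with
    | nil => rw [gam_of_lt (by simp)]; exact Submodule.zero_mem _
    | cons x r =>
      have h1 := offCount_lt_length (List.mem_cons_self (a := x) (l := r))
      have h2 : offCount c (x :: r) = (x :: r).length := by
        refine List.countP_eq_length.2 fun y hy => ?_
        simp only [decide_eq_true_eq]
        rintro rfl
        exact hc hy
      exact gam_mem_of_mem List.mem_cons_self (by omega)

/-- The step of depth `m` of the tensor square of `𝓛_{≥2}(F)`. -/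
def tensorDepth (F : Type u) [Field F] (m : ℕ) : Submodule ℚ (L F ⊗[ℚ] L F) :=
  Submodule.span ℚ {z | ∃ i j : ℕ, i + j ≤ m ∧ ∃ a ∈ depthFiltration F i,
    ∃ b ∈ depthFiltration F j, z = a ⊗ₜ b}

lemma wedge_mem_tensorDepth {m i j : ℕ} {a b : L F} (ha : a ∈ depthFiltration F i)
    (hb : b ∈ depthFiltration F j) (h : i = 0 ∨ j = 0 ∨ i + j ≤ m) :
    wedge a b ∈ tensorDepth F m := by
  rcases h with rfl | rfl | h
  · rw [eq_zero_of_mem_depthFiltration_zero ha, wedge_zero_left]; exact Submodule.zero_mem _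
  · rw [eq_zero_of_mem_depthFiltration_zero hb, wedge_zero_right]; exact Submodule.zero_mem _
  · exact Submodule.sub_mem _ (Submodule.subset_span ⟨i, j, h, a, ha, b, hb, rfl⟩)
      (Submodule.subset_span ⟨j, i, by omega, b, hb, a, ha, rfl⟩)

lemma cutSum_mem {m : ℕ} (c x : F) (r : List F)
    (h : offCount c (x :: r) + offCount c [x] ≤ m + 2) :
    cutSum gam (x :: r) ∈ tensorDepth F m := by
  refine Submodule.sum_mem _ fun j _ => wedge_mem_tensorDepth (gam_mem c _) (gam_mem c _) ?_
  have := offCount_cut c x r j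
  omega

lemma cutSum_mem_of_le {m : ℕ} (c : F) (v : List F) (h : offCount c v ≤ m + 1) :
    cutSum gam v ∈ tensorDepth F m := by
  cases v with
  | nil => simp [cutSum]
  | cons x r =>
    have := offCount_le_length c [x]
    exact cutSum_mem c x r (by simp at this; omega)

lemma truncCobracket_gam_mem {m : ℕ} (c : F) (w : List F) (h : offCount c w ≤ m + 1) :
    truncCobracket F (gam w) ∈ tensorDepth F m := by
  by_cases h3 : 3 ≤ w.length
  · rw [truncCobracket_gam h3]
    exact Submodule.sum_mem _ fun i _ => cutSum_mem_of_le c _ (by rwa [offCount_rotate])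
  · rw [gam_of_lt (by omega), map_zero]; exact Submodule.zero_mem _

/-- The truncated cobracket respects the depth filtration. -/
lemma truncCobracket_mem {m : ℕ} {x : L F} (hx : x ∈ depthFiltration F m) :
    truncCobracket F x ∈ tensorDepth F m := by
  suffices depthFiltration F m ≤ (tensorDepth F m).comap (truncCobracket F) from this hx
  refine Submodule.span_le.2 ?_
  rintro _ ⟨n₀, l, h1, h2, h3, rfl⟩
  have hc : offCount 0 (List.replicate n₀ 0 ++ polylogWord (1 : F) l) ≤ m + 1 := by
    rw [offCount_append, offCount_replicate_self, zero_add]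
    exact (offCount_polylogWord_le _ _).trans (by omega)
  rw [SetLike.mem_coe, Submodule.mem_comap, polylog_eq h3, map_smul, map_sub]
  refine Submodule.smul_mem _ _ (Submodule.sub_mem _ (truncCobracket_gam_mem 0 _ hc)
    (truncCobracket_gam_mem 0 _ ?_))
  rw [offCount_cons_self]
  exact (offCount_sublist _ (List.dropLast_sublist _)).trans hc

/-! ### The iterated cobracket and the depth -/

lemma tensorIterate_eq_zero {k m : ℕ} (h : m ≤ k) {x : L F} (hx : x ∈ depthFiltration F m) :
    tensorIterate (truncCobracket F) k x = 0 := by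
  induction k generalizing m x with
  | zero =>
    obtain rfl : m = 0 := by omega
    rw [eq_zero_of_mem_depthFiltration_zero hx, map_zero]
  | succ k ih =>
    rw [tensorIterate, LinearMap.comp_apply, LinearMap.comp_apply]
    suffices tensorDepth F m ≤ LinearMap.ker (LinearMap.mul' ℚ (TensorAlgebra ℚ (L F)) ∘ₗ
        TensorProduct.map (TensorAlgebra.ι ℚ) (tensorIterate (truncCobracket F) k)) from
      this (truncCobracket_mem hx)
    refine Submodule.span_le.2 ?_
    rintro _ ⟨i, j, hij, a, ha, b, hb, rfl⟩
    rw [SetLike.mem_coe, LinearMap.mem_ker, LinearMap.comp_apply, TensorProduct.map_tmul,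
      LinearMap.mul'_apply]
    by_cases hi : i = 0
    · subst hi; rw [eq_zero_of_mem_depthFiltration_zero ha]; simp
    · rw [ih (by omega : j ≤ k) hb, mul_zero]

/-- The next step of the iterated cobracket kills the part of the cobracket of smaller depth. -/
lemma mul_map_tensorIterate_eq_zero {k : ℕ} {z : L F ⊗[ℚ] L F} (hz : z ∈ tensorDepth F (k + 1)) :
    LinearMap.mul' ℚ (TensorAlgebra ℚ (L F)) (TensorProduct.map (TensorAlgebra.ι ℚ)
      (tensorIterate (truncCobracket F) k) z) = 0 := by
  suffices tensorDepth F (k + 1) ≤ LinearMap.ker (LinearMap.mul' ℚ (TensorAlgebra ℚ (L F)) ∘ₗ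
      TensorProduct.map (TensorAlgebra.ι ℚ) (tensorIterate (truncCobracket F) k)) from this hz
  refine Submodule.span_le.2 ?_
  rintro _ ⟨i, j, hij, a, ha, b, hb, rfl⟩
  rw [SetLike.mem_coe, LinearMap.mem_ker, LinearMap.comp_apply, TensorProduct.map_tmul,
    LinearMap.mul'_apply]
  by_cases hi : i = 0
  · subst hi; rw [eq_zero_of_mem_depthFiltration_zero ha]; simp
  · rw [tensorIterate_eq_zero (by omega : j ≤ k) hb, mul_zero]

lemma polylog_singleton {n₀ : ℕ} {n : ℕ+} {a : Fˣ} (h : 2 ≤ n₀ + (n : ℕ)) :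
    polylog n₀ [(n, a)] = -gam (depthOneWord n₀ ((n : ℕ) - 1) (a : F)) := by
  rw [polylog_eq (by simpa [polylogWeight] using h)]
  have : gam ((0 : F) :: (List.replicate n₀ 0 ++ 1 :: List.replicate ((n : ℕ) - 1) 0)) = 0 := by
    refine gam_eq_zero (c := 0) ?_
    rw [offCount_cons_self]
    exact offCount_replicate_append_cons_le _ _ _
  have e : List.replicate n₀ 0 ++ polylogWord (1 : F) [(n, a)] =
      List.replicate n₀ 0 ++ 1 :: List.replicate ((n : ℕ) - 1) 0 ++ [(a : F)] := by
    simp [polylogWord]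
  rw [e, List.dropLast_concat, this]
  simp [depthOneWord]

lemma classicalGam_mem (p : ℕ) {a : F} (ha : a ≠ 0) : classicalGam p a ∈ classicalSum F := by
  rcases p with _ | p
  · rw [classicalGam_zero]; exact Submodule.zero_mem _
  have hn : (2 : ℕ+) ≤ (p + 1).succPNat := by
    rw [← PNat.coe_le_coe, Nat.succPNat_coe]; simp
  refine Submodule.mem_iSup_of_mem (p + 1).succPNat (Submodule.mem_iSup_of_mem hn ?_)
  have h1 := polylog_singleton (n₀ := 0) (n := (p + 1).succPNat) (a := Units.mk0 a ha) (by simp)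
  rw [Nat.succPNat_coe, Nat.succ_eq_add_one, Nat.add_sub_cancel, Units.val_mk0] at h1
  have h2 := gam_depthOneWord 0 (p + 1) a
  rw [zero_add, Nat.choose_self, Nat.cast_one, mul_one] at h2
  have h3 : classicalGam (p + 1) a =
      -((-1 : ℚ) ^ (p + 1) • polylog 0 [((p + 1).succPNat, Units.mk0 a ha)]) := by
    rw [h1, h2, smul_neg, neg_neg, smul_smul, ← mul_pow, neg_one_mul, neg_neg, one_pow, one_smul]
  rw [h3]
  exact Submodule.neg_mem _ (Submodule.smul_mem _ _ (Submodule.subset_span ⟨_, rfl⟩))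

/-- Polylogarithms of depth one are classical. -/
lemma depthFiltration_one_le : depthFiltration F 1 ≤ classicalSum F := by
  refine Submodule.span_le.2 ?_
  rintro _ ⟨n₀, l, h1, h2, h3, rfl⟩
  obtain ⟨⟨n, a⟩, rfl⟩ := List.length_eq_one_iff.1 (le_antisymm h2 h1)
  rw [polylog_singleton (by simpa [polylogWeight] using h3), gam_depthOneWord]
  exact Submodule.neg_mem _ (Submodule.smul_mem _ _ (classicalGam_mem _ a.ne_zero))

/-- The classical polylogarithms as tensors of degree one. -/
def classicalTensor (F : Type u) [Field F] : Submodule ℚ (TensorAlgebra ℚ (L F)) :=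
  (classicalSum F).map (TensorAlgebra.ι ℚ)

lemma tensorIterate_mem {k : ℕ} {x : L F} (hx : x ∈ depthFiltration F (k + 1)) :
    tensorIterate (truncCobracket F) k x ∈ classicalTensor F ^ (k + 1) := by
  induction k generalizing x with
  | zero =>
    rw [zero_add, pow_one]
    exact Submodule.mem_map_of_mem (depthFiltration_one_le hx)
  | succ k ih =>
    rw [tensorIterate, LinearMap.comp_apply, LinearMap.comp_apply]
    suffices tensorDepth F (k + 2) ≤ (classicalTensor F ^ (k + 2)).comap
        (LinearMap.mul' ℚ (TensorAlgebra ℚ (L F)) ∘ₗ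
        TensorProduct.map (TensorAlgebra.ι ℚ) (tensorIterate (truncCobracket F) k)) from
      this (truncCobracket_mem hx)
    refine Submodule.span_le.2 ?_
    rintro _ ⟨i, j, hij, a, ha, b, hb, rfl⟩
    rw [SetLike.mem_coe, Submodule.mem_comap, LinearMap.comp_apply, TensorProduct.map_tmul,
      LinearMap.mul'_apply]
    by_cases hi : i = 0
    · subst hi; rw [eq_zero_of_mem_depthFiltration_zero ha]; simp
    by_cases hj : j ≤ k
    · rw [tensorIterate_eq_zero hj hb, mul_zero]; exact Submodule.zero_mem _
    obtain rfl : i = 1 := by omega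
    obtain rfl : j = k + 1 := by omega
    rw [pow_succ']
    exact Submodule.mul_mem_mul (Submodule.mem_map_of_mem (depthFiltration_one_le ha)) (ih hb)

end Gam

/-! ### The iterated adjoint of bracketing -/

section Dyn

/-- The segment of length `N` that starts at the index `i`. -/
def segment {α : Type*} (x : ℕ → α) (i N : ℕ) : List α := (List.range' i N).map x

@[simp] lemma length_segment {α : Type*} (x : ℕ → α) (i N : ℕ) :
    (segment x i N).length = N := by simp [segment]

@[simp] lemma segment_zero {α : Type*} (x : ℕ → α) (i : ℕ) : segment x i 0 = [] := rfl

lemma segment_succ {α : Type*} (x : ℕ → α) (i N : ℕ) :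
    segment x i (N + 1) = x i :: segment x (i + 1) N := by
  simp [segment, List.range'_succ]

lemma segment_add {α : Type*} (x : ℕ → α) (i M N : ℕ) :
    segment x i (M + N) = segment x i M ++ segment x (i + M) N := by
  rw [segment, segment, segment, ← List.map_append]
  congr 1
  exact (List.range'_append_1 ..).symm

lemma segment_succ' {α : Type*} (x : ℕ → α) (i N : ℕ) :
    segment x i (N + 1) = segment x i N ++ [x (i + N)] := by
  rw [segment_add]; rfl

/-- The adjoint of iterated bracketing: for the letters `w i, …, w (i + n)`, the alternating sum
of words obtained by repeatedly moving either the first letter (sign `+`) or the last letter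
(sign `-`) to the front. -/
def dyn {R : Type*} [Ring R] (w : ℕ → R) : ℕ → ℕ → R
  | 0, i => w i
  | n + 1, i => w i * dyn w n (i + 1) - w (i + n + 1) * dyn w n i

end Dyn

/-! ### Correlators with all zeros in one block -/

section Block
variable {F : Type u} [Field F]

/-- The correlator `Cor(0^k, xᵢ, …, xᵢ₊ₙ₊₁)`, of depth `n + 1`. -/
def block (k : ℕ) (x : ℕ → F) (n i : ℕ) : L F := gam (List.replicate k 0 ++ segment x i (n + 2))

lemma block_mem (k : ℕ) (x : ℕ → F) (n i : ℕ) : block k x n i ∈ depthFiltration F (n + 1) := by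
  refine depthFiltration_mono ?_ (gam_mem 0 _)
  have := offCount_le_length 0 (segment x i (n + 2))
  rw [length_segment] at this
  rw [offCount_append, offCount_replicate_self]
  omega

lemma cutSum_gam_eq_sum_range (v : List F) : cutSum gam v =
    ∑ j ∈ Finset.range v.length, wedge (gam (v.take (j + 1)))
      (gam (v.take 1 ++ v.drop (j + 1))) := by
  refine Finset.sum_subset (fun j hj => ?_) fun j hj hj' => ?_
  · simp only [Finset.mem_Ico, Finset.mem_range] at hj ⊢; omega
  · simp only [Finset.mem_Ico, Finset.mem_range] at hj hj'
    obtain rfl | h : j = 0 ∨ j + 1 = v.length := by omega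
    · rw [gam_of_lt (w := v.take (0 + 1)), wedge_zero_left]
      simp
    · rw [gam_of_lt (w := v.take 1 ++ v.drop (j + 1)), wedge_zero_right]
      rw [h, List.drop_length]; simp

/-- Up to smaller depth, the cuts that start at a fixed nonzero letter have to end inside the
block of zeros. -/
lemma cutSum_block {m k : ℕ} (y : F) (u₁ u₂ : List F) (h : u₁.length + u₂.length ≤ m + 1) :
    cutSum gam (y :: u₁ ++ (List.replicate k 0 ++ u₂)) -
      ∑ st ∈ Finset.HasAntidiagonal.antidiagonal k, wedge (gam (y :: u₁ ++ List.replicate st.1 0))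
        (gam (y :: (List.replicate st.2 0 ++ u₂))) ∈ tensorDepth F m := by
  set v := y :: u₁ ++ (List.replicate k 0 ++ u₂) with hv
  have hlen : v.length = u₁.length + (k + 1) + u₂.length := by simp [hv]; omega
  have h1 : v.take 1 = [y] := rfl
  rw [cutSum_gam_eq_sum_range, hlen, Finset.sum_range_add, Finset.sum_range_add,
    Finset.Nat.sum_antidiagonal_eq_sum_range_succ
      (fun s t => wedge (gam (y :: u₁ ++ List.replicate s 0))
        (gam (y :: (List.replicate t 0 ++ u₂))))]
  have hmid : ∀ s ∈ Finset.range (k + 1),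
      wedge (gam (v.take (u₁.length + s + 1))) (gam (v.take 1 ++ v.drop (u₁.length + s + 1))) =
      wedge (gam (y :: u₁ ++ List.replicate s 0))
        (gam (y :: (List.replicate (k - s) 0 ++ u₂))) := by
    intro s hs
    rw [Finset.mem_range] at hs
    have e : u₁.length + s + 1 = (y :: u₁).length + s := by simp; omega
    rw [h1, e, hv, List.take_length_add_append, List.drop_length_add_append,
      List.take_append_of_le_length (by simp; omega),
      List.drop_append_of_le_length (by simp; omega), List.take_replicate, List.drop_replicate,
      min_eq_left (by omega)]
    rfl
  rw [Finset.sum_congr rfl hmid, add_right_comm, add_sub_cancel_right]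
  refine Submodule.add_mem _ (Submodule.sum_mem _ fun j hj => ?_)
    (Submodule.sum_mem _ fun j hj => ?_)
  · rw [Finset.mem_range] at hj
    have eA : v.take (j + 1) = y :: u₁.take j := by
      rw [hv, List.take_append_of_le_length (by simp; omega), List.take_succ_cons]
    have eB : v.drop (j + 1) = u₁.drop j ++ (List.replicate k 0 ++ u₂) := by
      rw [hv, List.drop_append_of_le_length (by simp; omega), List.drop_succ_cons]
    have hA : offCount y (v.take (j + 1)) ≤ j := by
      rw [eA, offCount_cons_self]
      exact (offCount_le_length _ _).trans (by simp)
    have hB : offCount 0 (v.take 1 ++ v.drop (j + 1)) ≤ 1 + (u₁.length - j) + u₂.length := by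
      have l1 := offCount_le_length 0 [y]
      have l2 := offCount_le_length 0 (u₁.drop j)
      have l3 := offCount_le_length 0 u₂
      rw [h1, eB]
      simp only [offCount_append, offCount_replicate_self, List.length_singleton,
        List.length_drop] at l1 l2 l3 ⊢
      omega
    exact wedge_mem_tensorDepth (gam_mem y _) (gam_mem 0 _) (by omega)
  · rw [Finset.mem_range] at hj
    have eA : v.take (u₁.length + (k + 1) + j + 1) =
        y :: u₁ ++ (List.replicate k 0 ++ u₂.take (j + 1)) := by
      rw [show u₁.length + (k + 1) + j + 1 = (y :: u₁).length +
        ((List.replicate k (0 : F)).length + (j + 1)) by simp; omega, hv,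
        List.take_length_add_append, List.take_length_add_append]
    have eB : v.drop (u₁.length + (k + 1) + j + 1) = u₂.drop (j + 1) := by
      rw [show u₁.length + (k + 1) + j + 1 = (y :: u₁).length +
        ((List.replicate k (0 : F)).length + (j + 1)) by simp; omega, hv,
        List.drop_length_add_append, List.drop_length_add_append]
    have hA : offCount 0 (v.take (u₁.length + (k + 1) + j + 1)) ≤ u₁.length + 1 + (j + 1) := by
      have l1 := offCount_le_length 0 (y :: u₁)
      have l2 := offCount_le_length 0 (u₂.take (j + 1))
      rw [eA]
      simp only [offCount_append, offCount_replicate_self, List.length_cons,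
        List.length_take] at l1 l2 ⊢
      omega
    have hB : offCount y (v.take 1 ++ v.drop (u₁.length + (k + 1) + j + 1)) ≤
        u₂.length - (j + 1) := by
      rw [h1, eB, List.singleton_append, offCount_cons_self]
      exact (offCount_le_length _ _).trans (by simp)
    exact wedge_mem_tensorDepth (gam_mem 0 _) (gam_mem y _) (by omega)

/-- Up to smaller depth, the truncated cobracket of a correlator with all zeros in one block is
the antisymmetrized deconcatenation. -/
lemma truncCobracket_block (k : ℕ) (x : ℕ → F) (n i : ℕ) :
    truncCobracket F (block k x (n + 1) i) + ∑ j ∈ Finset.range (n + 1),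
      ∑ pq ∈ Finset.HasAntidiagonal.antidiagonal k, wedge (block pq.1 x j i) (block pq.2 x (n - j) (i + j + 1)) ∈
        tensorDepth F (n + 1) := by
  have hlen : (segment x i (n + 3) ++ List.replicate k 0).length = n + 3 + k := by simp
  rw [block, gam_append_comm, truncCobracket_gam (by rw [hlen]; omega), cyclicCut, hlen,
    Finset.sum_range_add, add_right_comm]
  refine Submodule.add_mem _ ?_ (Submodule.sum_mem _ fun s hs => ?_)
  swap
  · -- cuts that start at a zero
    rw [Finset.mem_range] at hs
    obtain ⟨t, ht⟩ : ∃ t, k - s = t + 1 := ⟨k - s - 1, by omega⟩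
    have e : (segment x i (n + 3) ++ List.replicate k 0).rotate (n + 3 + s) =
        0 :: (List.replicate t 0 ++ segment x i (n + 3) ++ List.replicate s 0) := by
      have hl := List.rotate_append_length_eq (segment x i (n + 3)) (List.replicate k 0)
      rw [length_segment] at hl
      rw [← List.rotate_rotate, hl, List.rotate_eq_drop_append_take (by simp; omega),
        List.drop_append_of_le_length (by simp; omega),
        List.take_append_of_le_length (by simp; omega), List.drop_replicate, ht,
        List.take_replicate, min_eq_left hs.le, List.replicate_succ]
      simp
    rw [e]
    refine cutSum_mem 0 _ _ ?_
    have := offCount_le_length 0 (segment x i (n + 3))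
    simp only [offCount_cons_self, offCount_append, offCount_replicate_self, offCount_nil,
      length_segment] at this ⊢
    omega
  -- cuts that start at the letter `x (i + r)`
  have hrot : ∀ r ∈ Finset.range (n + 3),
      (segment x i (n + 3) ++ List.replicate k 0).rotate r =
      x (i + r) :: segment x (i + r + 1) (n + 2 - r) ++ (List.replicate k 0 ++ segment x i r) := by
    intro r hr
    rw [Finset.mem_range] at hr
    have e : segment x i (n + 3) = segment x i r ++ segment x (i + r) (n + 2 - r + 1) := by
      rw [← segment_add]; congr 1; omega
    have := List.rotate_append_length_eq (segment x i r)
      (segment x (i + r) (n + 2 - r + 1) ++ List.replicate k 0)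
    rw [length_segment] at this
    rw [e, List.append_assoc, this, segment_succ, List.append_assoc]
  have hsum : ∑ r ∈ Finset.range (n + 3), (cutSum gam
      ((segment x i (n + 3) ++ List.replicate k 0).rotate r) -
      ∑ st ∈ Finset.HasAntidiagonal.antidiagonal k,
        wedge (gam (x (i + r) :: segment x (i + r + 1) (n + 2 - r) ++ List.replicate st.1 0))
        (gam (x (i + r) :: (List.replicate st.2 0 ++ segment x i r)))) ∈
        tensorDepth F (n + 1) := by
    refine Submodule.sum_mem _ fun r hr => ?_
    rw [hrot r hr]
    rw [Finset.mem_range] at hr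
    exact cutSum_block _ _ _ (by simp; omega)
  rw [Finset.sum_sub_distrib, sub_eq_add_neg] at hsum
  convert hsum using 2
  rw [Finset.sum_range_succ _ (n + 2), Finset.sum_range_succ' _ (n + 1)]
  have hfirst : ∑ st ∈ Finset.HasAntidiagonal.antidiagonal k,
      wedge (gam (x (i + 0) :: segment x (i + 0 + 1) (n + 2 - 0) ++ List.replicate st.1 0))
        (gam (x (i + 0) :: (List.replicate st.2 0 ++ segment x i 0))) = 0 := by
    refine Finset.sum_eq_zero fun st _ => ?_
    rw [gam_eq_zero (w := x (i + 0) :: (List.replicate st.2 0 ++ segment x i 0)) (c := 0),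
      wedge_zero_right]
    exact (offCount_cons_le _ _ _).trans (by simp)
  have hlast : ∑ st ∈ Finset.HasAntidiagonal.antidiagonal k,
      wedge (gam (x (i + (n + 2)) :: segment x (i + (n + 2) + 1) (n + 2 - (n + 2)) ++
        List.replicate st.1 0))
        (gam (x (i + (n + 2)) :: (List.replicate st.2 0 ++ segment x i (n + 2)))) = 0 := by
    refine Finset.sum_eq_zero fun st _ => ?_
    rw [gam_eq_zero (w := x (i + (n + 2)) :: segment x (i + (n + 2) + 1) (n + 2 - (n + 2)) ++
        List.replicate st.1 0) (c := 0), wedge_zero_left]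
    rw [Nat.sub_self, segment_zero]
    exact (offCount_cons_le _ _ _).trans (by simp)
  rw [hfirst, hlast, add_zero, add_zero, ← Finset.sum_neg_distrib]
  refine Finset.sum_congr rfl fun j hj => ?_
  rw [Finset.mem_range] at hj
  rw [← Finset.Nat.sum_antidiagonal_swap, ← Finset.sum_neg_distrib]
  refine Finset.sum_congr rfl fun st _ => ?_
  rw [wedge_swap, neg_inj, Prod.fst_swap, Prod.snd_swap]
  congr 1
  · rw [block, segment_succ, show n - j + 1 = n + 2 - (j + 1) by omega, gam_append_comm]
    simp [add_assoc]
  · rw [block, segment_succ', ← List.append_assoc, gam_append_comm]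
    simp

/-- The generating series of the depth one correlators `Cor(0^p, xⱼ, xⱼ₊₁)`. -/
def blockSeries (x : ℕ → F) (j : ℕ) : PowerSeries (TensorAlgebra ℚ (L F)) :=
  PowerSeries.mk fun p => TensorAlgebra.ι ℚ (block p x 0 j)

lemma tensorIterate_block (x : ℕ → F) (n : ℕ) : ∀ k i : ℕ,
    tensorIterate (truncCobracket F) n (block k x n i) =
      (-1 : ℚ) ^ n • PowerSeries.coeff k (dyn (blockSeries x) n i) := by
  induction n with
  | zero => intro k i; simp [dyn, blockSeries, tensorIterate]
  | succ n ih =>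
    intro k i
    set Φ := LinearMap.mul' ℚ (TensorAlgebra ℚ (L F)) ∘ₗ
      TensorProduct.map (TensorAlgebra.ι ℚ) (tensorIterate (truncCobracket F) n) with hΦ
    have hw : ∀ a b, Φ (wedge a b) =
        TensorAlgebra.ι ℚ a * tensorIterate (truncCobracket F) n b -
          TensorAlgebra.ι ℚ b * tensorIterate (truncCobracket F) n a := fun a b => by
      simp [hΦ, wedge]
    have h0 := mul_map_tensorIterate_eq_zero (truncCobracket_block k x n i)
    rw [← LinearMap.comp_apply, ← hΦ, map_add, map_sum] at h0
    have hterm : ∀ j ∈ Finset.range (n + 1),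
        Φ (∑ pq ∈ Finset.HasAntidiagonal.antidiagonal k,
          wedge (block pq.1 x j i) (block pq.2 x (n - j) (i + j + 1))) =
        (if j = 0 then ∑ pq ∈ Finset.HasAntidiagonal.antidiagonal k, TensorAlgebra.ι ℚ (block pq.1 x 0 i) *
          tensorIterate (truncCobracket F) n (block pq.2 x n (i + 1)) else 0) -
        if j = n then ∑ pq ∈ Finset.HasAntidiagonal.antidiagonal k,
          TensorAlgebra.ι ℚ (block pq.2 x 0 (i + n + 1)) *
          tensorIterate (truncCobracket F) n (block pq.1 x n i) else 0 := by
      intro j hj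
      rw [Finset.mem_range] at hj
      rw [map_sum]
      simp only [hw]
      rw [Finset.sum_sub_distrib]
      congr 1
      · split_ifs with h
        · subst h; rfl
        · refine Finset.sum_eq_zero fun pq _ => ?_
          rw [tensorIterate_eq_zero (by omega : n - j + 1 ≤ n) (block_mem _ _ _ _), mul_zero]
      · split_ifs with h
        · subst h; simp
        · refine Finset.sum_eq_zero fun pq _ => ?_
          rw [tensorIterate_eq_zero (by omega : j + 1 ≤ n) (block_mem _ _ _ _), mul_zero]
    rw [Finset.sum_congr rfl hterm, Finset.sum_sub_distrib, Finset.sum_ite_eq',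
      Finset.sum_ite_eq', if_pos (by simp), if_pos (by simp)] at h0
    change Φ (truncCobracket F (block k x (n + 1) i)) = _
    rw [eq_neg_of_add_eq_zero_left h0, dyn, map_sub, PowerSeries.coeff_mul, PowerSeries.coeff_mul,
      ← Finset.Nat.sum_antidiagonal_swap
        (f := fun pq => PowerSeries.coeff pq.1 (blockSeries x (i + n + 1)) *
          PowerSeries.coeff pq.2 (dyn (blockSeries x) n i))]
    simp only [ih, blockSeries, PowerSeries.coeff_mk, mul_smul_comm, Prod.fst_swap, Prod.snd_swap,
      ← Finset.smul_sum, ← smul_sub]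
    rw [pow_succ, mul_neg_one, neg_smul]

end Block

/-! ### Adjoint bracketing modulo shuffles -/

section Shuffle
variable {V : Type u} [AddCommGroup V] [Module ℚ V]

/-- The shuffle product of two tensor words. -/
def shuffleProd (u v : List V) : TensorAlgebra ℚ V := ((shuffles u v).map tensorWord).sum

lemma tensorWord_cons (a : V) (l : List V) :
    tensorWord (a :: l) = TensorAlgebra.ι ℚ a * tensorWord l := by simp [tensorWord]

lemma shuffleProd_nil_left (v : List V) : shuffleProd [] v = tensorWord v := by
  simp [shuffleProd, shuffles]

lemma shuffleProd_nil_right (u : List V) : shuffleProd u [] = tensorWord u := by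
  cases u <;> simp [shuffleProd, shuffles]

lemma shuffleProd_cons_cons (a b : V) (u v : List V) : shuffleProd (a :: u) (b :: v) =
    TensorAlgebra.ι ℚ a * shuffleProd u (b :: v) +
      TensorAlgebra.ι ℚ b * shuffleProd (a :: u) v := by
  simp [shuffleProd, shuffles, Function.comp_def, tensorWord_cons, List.sum_map_mul_left]

/-- The combination, with coefficients `a c`, of the shuffle products of an initial piece of
length `c` of a segment with the reversed rest. -/
def shuffleSum (v : ℕ → V) (a : ℕ → ℚ) (N i : ℕ) : TensorAlgebra ℚ V :=
  ∑ c ∈ Finset.range (N + 1), a c • shuffleProd (segment v i c) (segment v (i + c) (N - c)).reverse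

lemma shuffleSum_succ (v : ℕ → V) (a : ℕ → ℚ) (N i : ℕ) : shuffleSum v a (N + 1) i =
    TensorAlgebra.ι ℚ (v i) * shuffleSum v (fun c => a (c + 1)) N (i + 1) +
      TensorAlgebra.ι ℚ (v (i + N)) * shuffleSum v a N i := by
  have hpeel : ∀ c ∈ Finset.range (N + 2),
      a c • shuffleProd (segment v i c) (segment v (i + c) (N + 1 - c)).reverse =
      (if c = 0 then 0 else a c • (TensorAlgebra.ι ℚ (v i) *
        shuffleProd (segment v (i + 1) (c - 1)) (segment v (i + c) (N + 1 - c)).reverse)) +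
      if c = N + 1 then 0 else a c • (TensorAlgebra.ι ℚ (v (i + N)) *
        shuffleProd (segment v i c) (segment v (i + c) (N - c)).reverse) := by
    intro c hc
    rw [Finset.mem_range] at hc
    have hrev : c ≤ N → (segment v (i + c) (N + 1 - c)).reverse =
        v (i + N) :: (segment v (i + c) (N - c)).reverse := fun h => by
      rw [show N + 1 - c = N - c + 1 by omega, segment_succ', List.reverse_append,
        show i + c + (N - c) = i + N by omega]
      rfl
    rcases c with _ | c
    · rw [if_pos rfl, if_neg (by omega), zero_add, hrev (by omega), segment_zero,
        shuffleProd_nil_left, shuffleProd_nil_left, tensorWord_cons]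
    · rw [if_neg (by omega), Nat.add_sub_cancel, segment_succ v i c]
      by_cases h : c = N
      · subst h
        rw [if_pos rfl, Nat.sub_self, segment_zero, List.reverse_nil, shuffleProd_nil_right,
          shuffleProd_nil_right, tensorWord_cons, add_zero]
      · rw [if_neg (by omega), hrev (by omega), shuffleProd_cons_cons, smul_add]
  rw [shuffleSum, Finset.sum_congr rfl hpeel, Finset.sum_add_distrib]
  congr 1
  · rw [Finset.sum_range_succ', if_pos rfl, add_zero, shuffleSum, Finset.mul_sum]
    refine Finset.sum_congr rfl fun c _ => ?_
    rw [if_neg (by omega), Nat.add_sub_cancel, mul_smul_comm, Nat.add_sub_add_right,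
      show i + 1 + c = i + (c + 1) by omega]
  · rw [Finset.sum_range_succ, if_pos rfl, add_zero, shuffleSum, Finset.mul_sum]
    refine Finset.sum_congr rfl fun c hc => ?_
    rw [Finset.mem_range] at hc
    rw [if_neg (by omega), mul_smul_comm]

lemma shuffleSum_neg (v : ℕ → V) (a : ℕ → ℚ) (N i : ℕ) :
    shuffleSum v (fun c => -a c) N i = -shuffleSum v a N i := by
  simp [shuffleSum]

/-- The antipode identity of the shuffle algebra. -/
lemma shuffleSum_antipode (v : ℕ → V) (N : ℕ) : ∀ i : ℕ,
    shuffleSum v (fun c => (-1) ^ c) (N + 1) i = 0 := by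
  have hsucc : ∀ N i, shuffleSum v (fun c => (-1) ^ (c + 1)) N i =
      -shuffleSum v (fun c => (-1) ^ c) N i := fun N i => by
    rw [← shuffleSum_neg]; congr 1; ext c; ring
  induction N with
  | zero =>
    intro i
    have h0 : ∀ i, shuffleSum v (fun c => (-1) ^ c) 0 i = 1 := fun i => by
      simp [shuffleSum, shuffleProd_nil_left, tensorWord]
    rw [shuffleSum_succ, hsucc, h0, h0]
    simp
  | succ N ih =>
    intro i
    rw [shuffleSum_succ, hsucc, ih, ih]
    simp

/-- Adjoint bracketing is the convolution of the degree operator with the antipode. -/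
lemma shuffleSum_dyn (v : ℕ → V) (n : ℕ) : ∀ i : ℕ,
    shuffleSum v (fun c => c * (-1) ^ c) (n + 1) i =
      (-1 : ℚ) ^ (n + 1) • dyn (fun j => TensorAlgebra.ι ℚ (v j)) n i := by
  have hsucc : ∀ N i, shuffleSum v (fun c => ((c + 1 : ℕ) : ℚ) * (-1) ^ (c + 1)) N i =
      -(shuffleSum v (fun c => c * (-1) ^ c) N i + shuffleSum v (fun c => (-1) ^ c) N i) :=
    fun N i => by
      simp only [shuffleSum]
      rw [← Finset.sum_add_distrib, ← Finset.sum_neg_distrib]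
      refine Finset.sum_congr rfl fun c _ => ?_
      rw [← add_smul, ← neg_smul]
      congr 1
      push_cast; ring
  induction n with
  | zero =>
    intro i
    have h0 : ∀ i, shuffleSum v (fun c => c * (-1) ^ c) 0 i = 0 := fun i => by
      simp [shuffleSum]
    have h1 : ∀ i, shuffleSum v (fun c => (-1) ^ c) 0 i = 1 := fun i => by
      simp [shuffleSum, shuffleProd_nil_left, tensorWord]
    rw [shuffleSum_succ, hsucc, h0, h0, h1]
    simp [dyn]
  | succ n ih =>
    intro i
    rw [shuffleSum_succ, hsucc, ih, ih, shuffleSum_antipode, dyn, add_zero, smul_sub,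
      pow_succ _ (n + 1), mul_neg_one, neg_smul, neg_smul, mul_neg, mul_smul_comm, mul_smul_comm,
      show i + (n + 1) = i + n + 1 by omega]
    abel

/-- Modulo shuffle products, adjoint bracketing of a word of length `n + 1` multiplies it by
`n + 1`. -/
lemma dyn_sub_mem_shuffleSpan (v : ℕ → V) (n i : ℕ) :
    dyn (fun j => TensorAlgebra.ι ℚ (v j)) n i -
      ((n : ℚ) + 1) • tensorWord (segment v i (n + 1)) ∈ shuffleSpan V := by
  have h := shuffleSum_dyn v n i
  rw [shuffleSum, Finset.sum_range_succ, Nat.sub_self, segment_zero, List.reverse_nil,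
    shuffleProd_nil_right] at h
  have hmem : ∑ c ∈ Finset.range (n + 1), ((c : ℚ) * (-1) ^ c) •
      shuffleProd (segment v i c) (segment v (i + c) (n + 1 - c)).reverse ∈ shuffleSpan V := by
    refine Submodule.sum_mem _ fun c hc => ?_
    rw [Finset.mem_range] at hc
    by_cases h0 : c = 0
    · subst h0; simp
    · refine Submodule.smul_mem _ _ (Submodule.subset_span ⟨_, _, ?_, ?_, rfl⟩)
      · rw [Ne, ← List.length_eq_zero_iff, length_segment]; exact h0
      · rw [Ne, ← List.length_eq_zero_iff, List.length_reverse, length_segment]; omega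
  have hsq : ((-1 : ℚ) ^ (n + 1)) * (-1) ^ (n + 1) = 1 := by
    rw [← mul_pow, neg_one_mul, neg_neg, one_pow]
  have h' := congrArg (fun z => ((-1 : ℚ) ^ (n + 1)) • z) h
  simp only [smul_add, smul_smul, hsq, one_smul] at h'
  rw [← h', mul_left_comm, hsq, mul_one]
  push_cast
  rw [add_sub_cancel_right]
  exact Submodule.smul_mem _ _ hmem

end Shuffle

/-! ### Linearity of adjoint bracketing and truncation of series -/

section DynLinear
variable {R : Type*} [Ring R]

lemma dyn_congr {w w' : ℕ → R} {n i : ℕ} (h : ∀ j, i ≤ j → j ≤ i + n → w j = w' j) :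
    dyn w n i = dyn w' n i := by
  induction n generalizing i with
  | zero => exact h i le_rfl le_rfl
  | succ n ih =>
    rw [dyn, dyn, h i le_rfl (by omega), h (i + n + 1) (by omega) (by omega),
      ih fun j h1 h2 => h j (by omega) (by omega), ih fun j h1 h2 => h j (by omega) (by omega)]

/-- Adjoint bracketing is linear in each letter. -/
lemma exists_dyn_update [Algebra ℚ R] (w : ℕ → R) (m n : ℕ) : ∀ i, i ≤ m → m ≤ i + n →
    ∃ φ : R →ₗ[ℚ] R, ∀ a, dyn (Function.update w m a) n i = φ a := by
  induction n with
  | zero =>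
    intro i h1 h2
    obtain rfl : i = m := by omega
    exact ⟨LinearMap.id, fun a => by simp [dyn]⟩
  | succ n ih =>
    intro i h1 h2
    have hconst : ∀ i, (m < i ∨ i + n < m) → ∀ a,
        dyn (Function.update w m a) n i = dyn w n i := fun i hi a =>
      dyn_congr fun j h3 h4 => Function.update_of_ne (by omega) _ _
    by_cases hi : m = i
    · subst hi
      obtain ⟨φ, hφ⟩ := ih m le_rfl (by omega)
      refine ⟨LinearMap.mulRight ℚ (dyn w n (m + 1)) -
        LinearMap.mulLeft ℚ (w (m + n + 1)) ∘ₗ φ, fun a => ?_⟩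
      rw [dyn, Function.update_self, Function.update_of_ne (by omega), hconst _ (by omega), hφ]
      rfl
    by_cases hi' : m = i + n + 1
    · subst hi'
      obtain ⟨φ, hφ⟩ := ih (i + 1) (by omega) (by omega)
      refine ⟨LinearMap.mulLeft ℚ (w i) ∘ₗ φ - LinearMap.mulRight ℚ (dyn w n i), fun a => ?_⟩
      rw [dyn, Function.update_self, Function.update_of_ne (by omega), hconst i (by omega), hφ]
      rfl
    · obtain ⟨φ, hφ⟩ := ih i h1 (by omega)
      obtain ⟨ψ, hψ⟩ := ih (i + 1) (by omega) (by omega)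
      refine ⟨LinearMap.mulLeft ℚ (w i) ∘ₗ ψ - LinearMap.mulLeft ℚ (w (i + n + 1)) ∘ₗ φ,
        fun a => ?_⟩
      rw [dyn, Function.update_of_ne (Ne.symm hi), Function.update_of_ne (Ne.symm hi'), hφ, hψ]
      rfl

/-- The coefficients of small degree only depend on the truncation of the letters. -/
lemma coeff_dyn_congr {w w' : ℕ → PowerSeries R} {k : ℕ}
    (h : ∀ j, ∀ p ≤ k, PowerSeries.coeff p (w j) = PowerSeries.coeff p (w' j)) (n : ℕ) :
    ∀ i, ∀ p ≤ k, PowerSeries.coeff p (dyn w n i) = PowerSeries.coeff p (dyn w' n i) := by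
  induction n with
  | zero => exact h
  | succ n ih =>
    intro i p hp
    rw [dyn, dyn, map_sub, map_sub, PowerSeries.coeff_mul, PowerSeries.coeff_mul,
      PowerSeries.coeff_mul, PowerSeries.coeff_mul]
    congr 1 <;> refine Finset.sum_congr rfl fun st hst => ?_ <;>
      rw [Finset.HasAntidiagonal.mem_antidiagonal] at hst <;>
      rw [h _ _ (by omega), ih _ _ (by omega)]

lemma dyn_monomial (κ : ℕ → ℕ) (b : ℕ → R) (n : ℕ) : ∀ i,
    dyn (fun j => PowerSeries.monomial (κ j) (b j)) n i =
      PowerSeries.monomial (∑ j ∈ Finset.range (n + 1), κ (i + j)) (dyn b n i) := by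
  induction n with
  | zero => intro i; simp [dyn]
  | succ n ih =>
    intro i
    rw [dyn, ih, ih, PowerSeries.monomial_mul_monomial, PowerSeries.monomial_mul_monomial,
      dyn, map_sub]
    congr 2
    · rw [Finset.sum_range_succ' _ (n + 1), add_comm]
      simp [add_assoc, add_comm 1]
    · rw [Finset.sum_range_succ _ (n + 1), add_comm, add_assoc]

end DynLinear

/-! ### Separation of weights over a quadratically closed field -/

section Separation
variable {F : Type u} [Field F]

/-- The span of the sequences `p ↦ Li_{p+1}(a)` of classical polylogarithms of all weights (up to
sign). -/
def classicalSeq (F : Type u) [Field F] : Submodule ℚ (ℕ → L F) :=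
  Submodule.span ℚ {f | ∃ a : F, a ≠ 0 ∧ f = fun p => classicalGam p a}

/-- Rescaling of the variable of a generating series by `1 / 2`. -/
def halfScale (V : Type u) [AddCommGroup V] [Module ℚ V] : Module.End ℚ (ℕ → V) where
  toFun f p := ((2 : ℚ)⁻¹ ^ p) • f p
  map_add' f g := by ext p; simp
  map_smul' r f := by ext p; exact smul_comm _ _ _

/-- By the distribution relation for `a = b²`, rescaling by `1 / 2` preserves the span of the
generating series of classical polylogarithms. -/
lemma halfScale_mem (hF : ∀ a : F, IsSquare a) {f : ℕ → L F} (hf : f ∈ classicalSeq F) :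
    halfScale (L F) f ∈ classicalSeq F := by
  suffices classicalSeq F ≤ (classicalSeq F).comap (halfScale (L F)) from this hf
  refine Submodule.span_le.2 ?_
  rintro _ ⟨a, ha, rfl⟩
  obtain ⟨b, rfl⟩ := hF a
  have hb : b ≠ 0 := left_ne_zero_of_mul ha
  have : halfScale (L F) (fun p => classicalGam p (b * b)) =
      (fun p => classicalGam p b) + fun p => classicalGam p (-b) := by
    ext1 p
    change ((2 : ℚ)⁻¹ ^ p) • classicalGam p (b * b) = classicalGam p b + classicalGam p (-b)
    rw [← sq, classicalGam_sq, smul_smul, ← mul_pow, inv_mul_cancel₀ two_ne_zero, one_pow,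
      one_smul]
  rw [SetLike.mem_coe, Submodule.mem_comap, this]
  exact Submodule.add_mem _ (Submodule.subset_span ⟨b, hb, rfl⟩)
    (Submodule.subset_span ⟨-b, neg_ne_zero.2 hb, rfl⟩)

lemma halfScale_pow_apply {V : Type u} [AddCommGroup V] [Module ℚ V] (f : ℕ → V) (i p : ℕ) :
    (halfScale V ^ i) f p = (((2 : ℚ)⁻¹ ^ p) ^ i) • f p := by
  induction i with
  | zero => simp
  | succ i ih =>
    rw [pow_succ', Module.End.mul_apply]
    change ((2 : ℚ)⁻¹ ^ p) • ((halfScale V ^ i) f p) = _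
    rw [ih, smul_smul, ← pow_succ']

/-- Interpolation in the rescaling operator isolates a single weight, up to any given order. -/
lemma exists_isolated (hF : ∀ a : F, IsSquare a) {a : F} (ha : a ≠ 0) {κ k : ℕ} (h : κ ≤ k) :
    ∃ g ∈ classicalSeq F, ∀ p ≤ k, g p = if p = κ then classicalGam κ a else 0 := by
  set z : ℕ → ℚ := fun p => (2 : ℚ)⁻¹ ^ p with hz
  have hinj : Set.InjOn z (Finset.range (k + 1)) := fun x _ y _ hxy =>
    pow_right_injective₀ (by norm_num) (by norm_num) hxy
  set P := Lagrange.basis (Finset.range (k + 1)) z κ with hP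
  refine ⟨Polynomial.aeval (halfScale (L F)) P fun p => classicalGam p a, ?_, fun p hp => ?_⟩
  · rw [Polynomial.aeval_eq_sum_range, LinearMap.sum_apply]
    refine Submodule.sum_mem _ fun i hi => Submodule.smul_mem _ _ ?_
    clear hi
    induction i with
    | zero => exact Submodule.subset_span ⟨a, ha, rfl⟩
    | succ i ih => rw [pow_succ', Module.End.mul_apply]; exact halfScale_mem hF ih
  · have : Polynomial.aeval (halfScale (L F)) P (fun p => classicalGam p a) p =
        P.eval (z p) • classicalGam p a := by
      rw [Polynomial.aeval_eq_sum_range, LinearMap.sum_apply, Finset.sum_apply,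
        Polynomial.eval_eq_sum_range, Finset.sum_smul]
      refine Finset.sum_congr rfl fun i _ => ?_
      rw [LinearMap.smul_apply, Pi.smul_apply, halfScale_pow_apply, smul_smul]
    rw [this]
    split_ifs with hpk
    · subst hpk
      rw [hP, Lagrange.eval_basis_self hinj (by simpa using Nat.lt_succ_of_le h), one_smul]
    · rw [hP, Lagrange.eval_basis_of_ne (Ne.symm hpk)
        (by simpa using Nat.lt_succ_of_le hp), zero_smul]

/-- The generating series in the tensor algebra of a sequence. -/
def tensorSeries (V : Type u) [AddCommGroup V] [Module ℚ V] :
    (ℕ → V) →ₗ[ℚ] PowerSeries (TensorAlgebra ℚ V) where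
  toFun f := PowerSeries.mk fun p => TensorAlgebra.ι ℚ (f p)
  map_add' f g := by ext p; simp
  map_smul' r f := by ext p; simp

lemma coeff_tensorSeries {V : Type u} [AddCommGroup V] [Module ℚ V] (f : ℕ → V) (p : ℕ) :
    PowerSeries.coeff p (tensorSeries V f) = TensorAlgebra.ι ℚ (f p) :=
  PowerSeries.coeff_mk p fun p => TensorAlgebra.ι ℚ (f p)

/-- The image of the iterated truncated cobracket on the depth filtration, before passing to the
quotient by shuffles. -/
def iterateImage (F : Type u) [Field F] (n : ℕ) : Submodule ℚ (TensorAlgebra ℚ (L F)) :=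
  (depthFiltration F (n + 1)).map (tensorIterate (truncCobracket F) n)

lemma coeff_dyn_classicalGam_mem (n k : ℕ) (a : ℕ → F) (ha : ∀ j, a j ≠ 0) :
    PowerSeries.coeff k (dyn (fun j => tensorSeries (L F) fun p => classicalGam p (a j)) n 0) ∈
      iterateImage F n := by
  -- letters with prescribed successive ratios
  set x : ℕ → F := fun j => ∏ i ∈ Finset.range j, a i with hx
  have hx0 : ∀ j, x j ≠ 0 := fun j => Finset.prod_ne_zero_iff.2 fun i _ => ha i
  have hb : ∀ p j, block p x 0 j = classicalGam p (a j) := fun p j => by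
    rw [block, classicalGam, ← gam_scale (hx0 j) (depthOneWord p 0 (a j))]
    congr 1
    have : x (j + 1) = x j * a j := Finset.prod_range_succ _ _
    simp [segment_succ, depthOneWord, this]
  have h := tensorIterate_block x n k 0
  have hs : blockSeries x = fun j => tensorSeries (L F) fun p => classicalGam p (a j) := by
    ext1 j; ext p; rw [coeff_tensorSeries, blockSeries, PowerSeries.coeff_mk, hb]
  rw [hs] at h
  have h' := congrArg (fun z => ((-1 : ℚ) ^ n) • z) h
  simp only [smul_smul, ← mul_pow, neg_one_mul, neg_neg, one_pow, one_smul] at h'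
  rw [← h']
  exact Submodule.smul_mem _ _ (Submodule.mem_map_of_mem (block_mem k x n 0))

lemma coeff_dyn_mem (n k : ℕ) (g : ℕ → ℕ → L F) (hg : ∀ j, g j ∈ classicalSeq F) :
    PowerSeries.coeff k (dyn (fun j => tensorSeries (L F) (g j)) n 0) ∈ iterateImage F n := by
  have key : ∀ r, r ≤ n + 1 → ∀ g : ℕ → ℕ → L F, (∀ j < r, g j ∈ classicalSeq F) →
      (∀ j, r ≤ j → ∃ a : F, a ≠ 0 ∧ g j = fun p => classicalGam p a) →
      PowerSeries.coeff k (dyn (fun j => tensorSeries (L F) (g j)) n 0) ∈ iterateImage F n := by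
    intro r
    induction r with
    | zero =>
      intro _ g _ hg
      choose a ha hga using fun j => hg j (Nat.zero_le j)
      simp only [hga]
      exact coeff_dyn_classicalGam_mem n k a ha
    | succ r ih =>
      intro hr g hg hg'
      obtain ⟨φ, hφ⟩ := exists_dyn_update (fun j => tensorSeries (L F) (g j)) r n 0
        (Nat.zero_le r) (by omega)
      have hupd : ∀ f : ℕ → L F, dyn (fun j => tensorSeries (L F) (Function.update g r f j)) n 0 =
          φ (tensorSeries (L F) f) := fun f => by
        rw [← hφ]
        congr 1; ext1 j
        by_cases hj : j = r
        · subst hj; simp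
        · simp [Function.update_of_ne hj]
      have hlin : ∀ f ∈ classicalSeq F,
          PowerSeries.coeff k (φ (tensorSeries (L F) f)) ∈ iterateImage F n := by
        intro f hf
        induction hf using Submodule.span_induction with
        | mem f hf =>
          rw [← hupd]
          refine ih (by omega) _ (fun j hj => ?_) fun j hj => ?_
          · rw [Function.update_of_ne (by omega)]; exact hg j (by omega)
          · by_cases hjr : j = r
            · subst hjr; rw [Function.update_self]; exact hf
            · rw [Function.update_of_ne hjr]; exact hg' j (by omega)
        | zero => simp
        | add f f' _ _ h h' => rw [map_add, map_add, map_add]; exact Submodule.add_mem _ h h'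
        | smul c f _ h =>
          rw [map_smul, map_smul, PowerSeries.coeff_smul]
          exact Submodule.smul_mem _ _ h
      have := hlin (g r) (hg r (by omega))
      rwa [← hupd, Function.update_eq_self] at this
  -- letters beyond the index `n` do not matter
  have h := key (n + 1) le_rfl (fun j => if j < n + 1 then g j else fun p => classicalGam p 1)
    (fun j hj => by rw [if_pos hj]; exact hg j)
    fun j hj => ⟨1, one_ne_zero, by rw [if_neg (by omega)]⟩
  rwa [dyn_congr (w' := fun j => tensorSeries (L F) (g j)) fun j _ hj => by
    rw [if_pos (by omega)]] at h

lemma dyn_classicalGam_mem (hF : ∀ a : F, IsSquare a) (n : ℕ) (a : ℕ → F) (ha : ∀ j, a j ≠ 0)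
    (κ : ℕ → ℕ) :
    dyn (fun j => TensorAlgebra.ι ℚ (classicalGam (κ j) (a j))) n 0 ∈ iterateImage F n := by
  set k := ∑ j ∈ Finset.range (n + 1), κ (0 + j) with hk
  have hle : ∀ j, j ≤ n → κ j ≤ k := fun j hj => by
    have := Finset.single_le_sum (f := fun j => κ (0 + j)) (fun _ _ => Nat.zero_le _)
      (Finset.mem_range.2 (Nat.lt_succ_of_le hj))
    simpa [k] using this
  have hex : ∀ j, ∃ g ∈ classicalSeq F, j ≤ n → ∀ p ≤ k,
      g p = if p = κ j then classicalGam (κ j) (a j) else 0 := fun j => by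
    by_cases hj : j ≤ n
    · obtain ⟨g, h1, h2⟩ := exists_isolated hF (ha j) (hle j hj)
      exact ⟨g, h1, fun _ => h2⟩
    · exact ⟨0, Submodule.zero_mem _, fun h => absurd h hj⟩
  choose g hg hgp using hex
  have h := coeff_dyn_mem n k g hg
  set w : ℕ → PowerSeries (TensorAlgebra ℚ (L F)) := fun j =>
    if j ≤ n then tensorSeries (L F) (g j) else
      PowerSeries.monomial (κ j) (TensorAlgebra.ι ℚ (classicalGam (κ j) (a j))) with hw
  have h1 : dyn (fun j => tensorSeries (L F) (g j)) n 0 = dyn w n 0 :=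
    dyn_congr fun j _ hj => by simp only [hw]; rw [if_pos (by omega)]
  have h2 := coeff_dyn_congr (k := k) (w := w) (w' := fun j =>
    PowerSeries.monomial (κ j) (TensorAlgebra.ι ℚ (classicalGam (κ j) (a j)))) (fun j p hp => by
      simp only [hw]
      split_ifs with hj
      · rw [coeff_tensorSeries, hgp j hj p hp, PowerSeries.coeff_monomial]
        split_ifs <;> simp
      · rfl) n 0 k le_rfl
  rw [h1, h2, dyn_monomial, ← hk, PowerSeries.coeff_monomial_same] at h
  exact h

/-! ### The image of the iterated cobracket -/

lemma classicalSum_le_span : classicalSum F ≤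
    Submodule.span ℚ {x | ∃ (p : ℕ) (a : F), a ≠ 0 ∧ x = classicalGam p a} := by
  refine iSup_le fun n => iSup_le fun hn => Submodule.span_le.2 ?_
  rintro _ ⟨a, rfl⟩
  have h2 : 2 ≤ (n : ℕ) := hn
  simp only [SetLike.mem_coe]
  rw [polylog_singleton (by omega), gam_depthOneWord]
  exact Submodule.neg_mem _ (Submodule.smul_mem _ _ (Submodule.subset_span ⟨_, a, a.ne_zero, rfl⟩))

open scoped Pointwise in
/-- Over a quadratically closed field, every tensor of classical polylogarithms is, modulo
shuffles, in the image of the iterated truncated cobracket. -/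
lemma mkQ_mem_of_mem_pow (hF : ∀ a : F, IsSquare a) {n : ℕ} {z : TensorAlgebra ℚ (L F)}
    (hz : z ∈ classicalTensor F ^ (n + 1)) : (shuffleSpan (L F)).mkQ z ∈
      (depthFiltration F (n + 1)).map (iteratedCobracket (truncCobracket F) n) := by
  have hword : ∀ (κ : ℕ → ℕ) (a : ℕ → F), (∀ j, a j ≠ 0) → (shuffleSpan (L F)).mkQ
      (tensorWord (segment (fun j => classicalGam (κ j) (a j)) 0 (n + 1))) ∈
      (depthFiltration F (n + 1)).map (iteratedCobracket (truncCobracket F) n) := by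
    intro κ a ha
    obtain ⟨y, hy, hyz⟩ := dyn_classicalGam_mem hF n a ha κ
    refine ⟨y, hy, ?_⟩
    have h := dyn_sub_mem_shuffleSpan (fun j => classicalGam (κ j) (a j)) n 0
    rw [← hyz] at h
    have h' := (Submodule.Quotient.eq _).2 h
    rw [iteratedCobracket, LinearMap.smul_apply, LinearMap.comp_apply, Submodule.mkQ_apply, h',
      Submodule.Quotient.mk_smul, smul_smul, inv_mul_cancel₀ (by positivity), one_smul]
    rfl
  have hle : classicalTensor F ≤ Submodule.span ℚ
      {z | ∃ (p : ℕ) (a : F), a ≠ 0 ∧ z = TensorAlgebra.ι ℚ (classicalGam p a)} := by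
    refine (Submodule.map_mono classicalSum_le_span).trans ?_
    rw [Submodule.map_span]
    refine Submodule.span_mono ?_
    rintro _ ⟨_, ⟨p, a, ha, rfl⟩, rfl⟩
    exact ⟨p, a, ha, rfl⟩
  have hz' := pow_le_pow_left' hle (n + 1) hz
  rw [Submodule.span_pow] at hz'
  suffices H : Submodule.span ℚ ({z | ∃ (p : ℕ) (a : F), a ≠ 0 ∧
      z = TensorAlgebra.ι ℚ (classicalGam p a)} ^ (n + 1)) ≤
      ((depthFiltration F (n + 1)).map (iteratedCobracket (truncCobracket F) n)).comap
        (shuffleSpan (L F)).mkQ from H hz'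
  refine Submodule.span_le.2 fun y hy => ?_
  obtain ⟨f, rfl⟩ := Set.mem_pow.1 hy
  choose p a ha hpa using fun i => (f i).2
  have := hword (fun j => if h : j < n + 1 then p ⟨j, h⟩ else 0)
    (fun j => if h : j < n + 1 then a ⟨j, h⟩ else 1) fun j => by
      split_ifs
      · exact ha _
      · exact one_ne_zero
  rw [SetLike.mem_coe, Submodule.mem_comap]
  convert this using 2
  rw [tensorWord]
  congr 1
  refine List.ext_getElem (by simp) fun i h1 h2 => ?_
  have hi : i < n + 1 := by simpa using h1
  simp only [segment, List.getElem_ofFn, List.getElem_map, List.getElem_range', hpa, zero_add,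
    one_mul, dif_pos hi]

/-! ### The induced map -/

lemma coLieMap_comp {U V W : Type u} [AddCommGroup U] [Module ℚ U] [AddCommGroup V] [Module ℚ V]
    [AddCommGroup W] [Module ℚ W] (f : U →ₗ[ℚ] V) (g : V →ₗ[ℚ] W) (x : CoLieTotal U) :
    coLieMap g (coLieMap f x) = coLieMap (g ∘ₗ f) x := by
  obtain ⟨x, rfl⟩ := Submodule.Quotient.mk_surjective _ x
  have : (tensorMap g).comp (tensorMap f) = tensorMap (g ∘ₗ f) := by
    apply TensorAlgebra.hom_ext
    ext v
    simp [tensorMap]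
  rw [coLieMap, coLieMap, coLieMap, Submodule.mapQ_apply, Submodule.mapQ_apply,
    Submodule.mapQ_apply, ← this]
  rfl

lemma coLieMap_id {V : Type u} [AddCommGroup V] [Module ℚ V] (x : CoLieTotal V) :
    coLieMap (LinearMap.id : V →ₗ[ℚ] V) x = x := by
  obtain ⟨x, rfl⟩ := Submodule.Quotient.mk_surjective _ x
  have : tensorMap (LinearMap.id : V →ₗ[ℚ] V) = AlgHom.id ℚ _ := by
    apply TensorAlgebra.hom_ext
    ext v
    simp [tensorMap]
  rw [coLieMap, Submodule.mapQ_apply, this]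
  rfl

/-- The image of `coLie_d` of the classical polylogarithms in the quotient of the tensor algebra
of `𝓛(F)` by shuffles. -/
lemma map_coLie_classicalSum (d : ℕ) :
    (coLie (classicalSum F) d).map (coLieMap (classicalSum F).subtype) =
      (classicalTensor F ^ d).map (shuffleSpan (L F)).mkQ := by
  have h1 : coLieMap (classicalSum F).subtype ∘ₗ (shuffleSpan (classicalSum F)).mkQ =
      (shuffleSpan (L F)).mkQ ∘ₗ (tensorMap (classicalSum F).subtype).toLinearMap := rfl
  have h2 : (LinearMap.range (TensorAlgebra.ι ℚ (M := classicalSum F))).map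
      (tensorMap (classicalSum F).subtype).toLinearMap = classicalTensor F := by
    rw [classicalTensor, ← LinearMap.range_comp]
    have : (tensorMap (classicalSum F).subtype).toLinearMap ∘ₗ TensorAlgebra.ι ℚ =
        TensorAlgebra.ι ℚ ∘ₗ (classicalSum F).subtype := by
      ext v; simp [tensorMap]
    rw [this, LinearMap.range_comp, Submodule.range_subtype]
  rw [coLie, ← Submodule.map_comp, h1, Submodule.map_comp, Submodule.map_pow, h2]

end Separation

end Polylog

end


theorem theorem2 {F : Type*} [Field F] (hF : ∀ a : F, IsSquare a) (d : ℕ) (hd : 1 ≤ d) :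
    ∃ φ : Polylog.depthGraded F d →ₗ[ℚ] Polylog.coLie (Polylog.classicalSum F) d,
      Polylog.IsInducedByTruncCobracket F d φ ∧
      (∀ ψ : Polylog.depthGraded F d →ₗ[ℚ] Polylog.coLie (Polylog.classicalSum F) d,
        Polylog.IsInducedByTruncCobracket F d ψ → ψ = φ) ∧
      Function.Surjective φ := by
  open Polylog in
  obtain ⟨n, rfl⟩ : ∃ n, d = n + 1 := ⟨d - 1, by omega⟩
  set ι := coLieMap (classicalSum F).subtype with hι
  set Δ := iteratedCobracket (truncCobracket F) n with hΔ
  -- a linear retraction onto the classical polylogarithms makes `ι` injective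
  obtain ⟨π, hπ⟩ := (classicalSum F).subtype.exists_leftInverse_of_injective
    (LinearMap.ker_eq_bot.2 (Submodule.subtype_injective _))
  have hret : ∀ x, coLieMap π (ι x) = x := fun x => by
    rw [hι, coLieMap_comp, hπ, coLieMap_id]
  have hinj : Function.Injective ι := Function.LeftInverse.injective hret
  have himage : ∀ x ∈ depthFiltration F (n + 1),
      Δ x ∈ (coLie (classicalSum F) (n + 1)).map ι := by
    intro x hx
    rw [hι, map_coLie_classicalSum, hΔ, iteratedCobracket, LinearMap.smul_apply]
    exact Submodule.smul_mem _ _ (Submodule.mem_map_of_mem (tensorIterate_mem hx))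
  have hlow : ∀ x ∈ depthFiltration F n, Δ x = 0 := by
    intro x hx
    rw [hΔ, iteratedCobracket, LinearMap.smul_apply, LinearMap.comp_apply,
      tensorIterate_eq_zero le_rfl hx, map_zero, smul_zero]
  have hmem : ∀ x : depthFiltration F (n + 1),
      (coLieMap π ∘ₗ Δ) x ∈ coLie (classicalSum F) (n + 1) := by
    intro x
    obtain ⟨y, hy, hyx⟩ := himage x x.2
    rw [LinearMap.comp_apply, ← hyx, hret]
    exact hy
  set Φ : depthFiltration F (n + 1) →ₗ[ℚ] coLie (classicalSum F) (n + 1) :=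
    LinearMap.codRestrict _ ((coLieMap π ∘ₗ Δ) ∘ₗ (depthFiltration F (n + 1)).subtype) hmem
    with hΦ
  have hιΦ : ∀ x, ι (Φ x) = Δ x := by
    intro x
    obtain ⟨y, hy, hyx⟩ := himage x x.2
    change ι (coLieMap π (Δ x)) = Δ x
    rw [← hyx, hret]
  have hker : (depthFiltration F (n + 1 - 1)).submoduleOf (depthFiltration F (n + 1)) ≤
      LinearMap.ker Φ := by
    intro x hx
    rw [LinearMap.mem_ker]
    apply Subtype.ext
    apply hinj
    rw [hιΦ, hlow x hx, ZeroMemClass.coe_zero, map_zero]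
  refine ⟨Submodule.liftQ _ Φ hker, fun x => ?_, fun ψ hψ => ?_, fun y => ?_⟩
  · exact hιΦ x
  · refine LinearMap.ext fun x => ?_
    obtain ⟨x, rfl⟩ := Submodule.Quotient.mk_surjective _ x
    apply Subtype.ext
    apply hinj
    exact (hψ x).trans (hιΦ x).symm
  · have hy : ι y ∈ (classicalTensor F ^ (n + 1)).map (shuffleSpan (L F)).mkQ := by
      rw [← map_coLie_classicalSum]
      exact Submodule.mem_map_of_mem y.2
    obtain ⟨z, hz, hzy⟩ := hy
    obtain ⟨x, hx, hxz⟩ := mkQ_mem_of_mem_pow hF hz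
    refine ⟨Submodule.Quotient.mk ⟨x, hx⟩, ?_⟩
    apply Subtype.ext
    apply hinj
    exact (hιΦ ⟨x, hx⟩).trans (hxz.trans hzy)
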